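/- Let $d\ge 1$, let $\mathbb B^d$ be the closed unit ball and $\mathbb S^{d-1}$ the unit sphere of $\mathbb R^d$, let $d\omega$ be the (unnormalised) surface measure on $\mathbb S^{d-1}$ (for $d=1$: counting measure on $\{\pm1\}$), and let $\mathbb I=[-1,1]$, $w(t)=(1-t^2)^{\frac{d-1}2}$. Write $(a)_k=a(a+1)\cdots(a+k-1)$, $(a)_0=1$. Let $G_k^{\nu}$ be the Gegenbauer polynomials, and put $$U_k=h_{k,d/2}^{-1/2}\,G_k^{d/2},\quad h_{k,\nu}=\frac{\pi^{1/2}(2\nu)_k\Gamma(\nu+\frac12)}{(k+\nu)\,k!\,\Gamma(\nu)},\quad v_k=\left(\frac{(k+1)_{d-1}}{2(2\pi)^{d-1}}\right)^{1/2}.$$ For $\alpha\in\mathbb R$ let $W^\alpha(L^2(\mathbb I,w))$ be the space of $g\in L^2(\mathbb I,w)$ with $$\|g\|^2_{W^\alpha(L^2(\mathbb I,w))}=\sum_{k\ge0}\Big[(k+1)^\alpha\int_{\mathbb I}g\,U_k\,w\,dt\Big]^2<\infty .$$ For every $j\ge0$ let $\{Y_{j,i}\}_{i=1}^{D_j}$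 be an orthonormal basis, in $L^2(\mathbb S^{d-1},d\omega)$, of the space of spherical harmonics of degree $j$ on $\mathbb S^{d-1}$ (of dimension $D_j$), and put $$P_{k,j,i}(x)=v_k\int_{\mathbb S^{d-1}}Y_{j,i}(\xi)\,U_k(x\cdot\xi)\,d\omega(\xi).$$ For $r\in\mathbb R$ let $H^r(L^2(\mathbb B^d))$ be the space of $f\in L^2(\mathbb B^d)$ with $$\|f\|^2_{H^r(L^2(\mathbb B^d))}=\sum_{k\ge0}\ \sum_{\substack{0\le j\le k\\ j\equiv k\,(2)}}\ \sum_{i=1}^{D_j}\Big[(k+1)^r\int_{\mathbb B^d}f\,P_{k,j,i}\,dx\Big]^2<\infty .$$ There is a constant $c>0$ depending only on $d$ (not on the choice of the $Y_{j,i}$) with the following property. Let $s\ge0$ and $n\ge 0$ be integers, and let $\lambda_1,\dots,\lambda_n>0$ and $\xi_1,\dots,\xi_n\in\mathbb S^{d-1}$ be such that $$\int_{\mathbb S^{d-1}}q\,d\omega=\sum_{\ell=1}^n\lambda_\ell\,q(\xi_\ell)$$ for every polynomial $q$ in $d$ real variables of degree at most $2s$. Let $P$ be a real polynomial in $d$ variables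 of degree at most $s$, and define the univariate polynomials $$p_\ell(t)=\sum_{k=0}^s v_k^2\left(\int_{\mathbb B^d}U_k(\xi_\ell\cdot y)P(y)\,dy\right)U_k(t),\qquad \ell=1,\dots,n .$$ Then $$P(x)=\sum_{\ell=1}^n\lambda_\ell\,p_\ell(\xi_\ell\cdot x)\qquad\text{for all }x\in\mathbb B^d;$$ moreover $p_\ell\in W^1(L^2(\mathbb I,w))$ for all $\ell$, $P\in H^{\frac{d+1}2}(L^2(\mathbb B^d))$, and $$\sum_{\ell=1}^n\lambda_\ell\,\|p_\ell\|^2_{W^1(L^2(\mathbb I,w))}\le c\,\|P\|^2_{H^{\frac{d+1}2}(L^2(\mathbb B^d))}.$$ -/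

import Mathlib

open MeasureTheory Polynomial

noncomputable section

namespace RidgeBall

/-- The Euclidean space `ℝ^d`. -/
abbrev E (d : ℕ) : Type := EuclideanSpace ℝ (Fin d)

/-- The unit sphere `𝕊^{d-1}` of `ℝ^d`. -/
abbrev S (d : ℕ) : Type := Metric.sphere (0 : E d) 1

/-- The closed unit ball `𝔹^d` of `ℝ^d`. -/
def unitBall (d : ℕ) : Set (E d) := Metric.closedBall 0 1

/-- The (unnormalised) surface measure `dω_{d-1}` of the sphere, of total mass
`2 π^{d/2} / Γ(d/2)`. -/
def surfaceMeasure (d : ℕ) : Measure (S d) := (volume : Measure (E d)).toSphere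

/-! ### Univariate orthonormal polynomials and Sobolev spaces -/

/-- The Gegenbauer polynomials `G_s^ν`: `G_0 = 1`, `G_1 = 2 ν t` and
`(s + 2) G_{s+2} = 2 (s + 1 + ν) t G_{s+1} - (s + 2 ν) G_s`. -/
def gegenbauer (ν : ℝ) : ℕ → ℝ[X]
  | 0 => 1
  | 1 => C (2 * ν) * X
  | s + 2 => C (((s : ℝ) + 2)⁻¹) *
      (C (2 * ((s : ℝ) + 1 + ν)) * X * gegenbauer ν (s + 1)
        - C ((s : ℝ) + 2 * ν) * gegenbauer ν s)

/-- The rising factorial `(a)_s = a (a + 1) ⋯ (a + s - 1)`, with `(a)_0 = 1`. -/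
def risingFactorial (a : ℝ) (s : ℕ) : ℝ := ∏ i ∈ Finset.range s, (a + (i : ℝ))

/-- `h_{s,ν} = π^{1/2} (2ν)_s Γ(ν + 1/2) / ((s + ν) s! Γ(ν))`, the squared norm of `G_s^ν`. -/
def gegenbauerNormSq (s : ℕ) (ν : ℝ) : ℝ :=
  √Real.pi * risingFactorial (2 * ν) s * Real.Gamma (ν + 1 / 2) /
    (((s : ℝ) + ν) * (s.factorial : ℝ) * Real.Gamma ν)

/-- `U_s = h_{s,d/2}^{-1/2} G_s^{d/2}`. -/
def U (d s : ℕ) : ℝ[X] :=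
  C ((√(gegenbauerNormSq s ((d : ℝ) / 2)))⁻¹) * gegenbauer ((d : ℝ) / 2) s

/-- The interval `𝕀 = [-1, 1]`. -/
def I : Set ℝ := Set.Icc (-1) 1

/-- The weight `w(t) = (1 - t²)^{(d-1)/2}` on `𝕀`. -/
def w (d : ℕ) (t : ℝ) : ℝ := (1 - t ^ 2) ^ (((d : ℝ) - 1) / 2)

/-- The coefficient `ĝ_{w,k} = ∫_𝕀 g U_k w`. -/
def coeffI (d : ℕ) (g : ℝ → ℝ) (k : ℕ) : ℝ := ∫ t in I, g t * (U d k).eval t * w d t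

/-- The squared norm of the univariate Sobolev space `W^α(L²(𝕀, w))`. -/
def normSqW (d : ℕ) (α : ℝ) (g : ℝ → ℝ) : ℝ :=
  ∑' k : ℕ, (((k : ℝ) + 1) ^ α * coeffI d g k) ^ 2

/-- Membership in the univariate Sobolev space `W^α(L²(𝕀, w))`: the function is in `L²(𝕀, w)`
and the series defining the squared norm converges. -/
def MemW (d : ℕ) (α : ℝ) (g : ℝ → ℝ) : Prop :=
  MemLp g 2 ((volume.restrict I).withDensity fun t => ENNReal.ofReal (w d t)) ∧
    Summable fun k : ℕ => (((k : ℝ) + 1) ^ α * coeffI d g k) ^ 2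

/-! ### Spherical harmonics -/

/-- The Laplace operator on polynomials in `d` variables. -/
def polyLaplacian (d : ℕ) : MvPolynomial (Fin d) ℝ →ₗ[ℝ] MvPolynomial (Fin d) ℝ :=
  ∑ i : Fin d, (MvPolynomial.pderiv (R := ℝ) i).toLinearMap ∘ₗ
    (MvPolynomial.pderiv (R := ℝ) i).toLinearMap

/-- The function on `ℝ^d` defined by a polynomial in `d` variables. -/
def polyFun {d : ℕ} (q : MvPolynomial (Fin d) ℝ) (x : E d) : ℝ :=
  MvPolynomial.eval (fun i => x i) q

/-- Restriction of polynomials to the sphere, as a linear map. -/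
def restrictSphere (d : ℕ) : MvPolynomial (Fin d) ℝ →ₗ[ℝ] (S d → ℝ) where
  toFun q := fun ξ => polyFun q ξ
  map_add' p q := by ext ξ; simp [polyFun]
  map_smul' c q := by ext ξ; simp [polyFun]

/-- The space `ℍ_j^{d-1}` of spherical harmonics of degree `j`: restrictions to the sphere of the
homogeneous harmonic polynomials of degree `j`. -/
def sphericalHarmonics (d j : ℕ) : Submodule ℝ (S d → ℝ) :=
  (MvPolynomial.homogeneousSubmodule (Fin d) ℝ j ⊓ LinearMap.ker (polyLaplacian d)).map
    (restrictSphere d)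

/-- The dimension `D_j^{d-1}` of `ℍ_j^{d-1}`. -/
def harmonicDim (d j : ℕ) : ℕ := Module.finrank ℝ (sphericalHarmonics d j)

/-- `Y_{j,i}`, `1 ≤ i ≤ D_j^{d-1}`, is for every `j` an orthonormal basis of `ℍ_j^{d-1}` with
respect to the surface measure. -/
structure IsHarmonicONB (d : ℕ) (Y : (j : ℕ) → Fin (harmonicDim d j) → S d → ℝ) : Prop where
  span_eq : ∀ j, Submodule.span ℝ (Set.range (Y j)) = sphericalHarmonics d j
  orthonormal : ∀ j i i', ∫ ξ, Y j i ξ * Y j i' ξ ∂(surfaceMeasure d) = if i = i' then 1 else 0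

/-! ### The orthonormal polynomials on the ball and the Sobolev spaces -/

/-- `v_k = ((k + 1)_{d-1} / (2 (2π)^{d-1}))^{1/2}`, for `d ≥ 1`. -/
def v (d k : ℕ) : ℝ :=
  √(risingFactorial ((k : ℝ) + 1) (d - 1) / (2 * (2 * Real.pi) ^ (d - 1)))

/-- `P_{k,j,i}(x) = v_k ∫_{𝕊^{d-1}} Y_{j,i}(ξ) U_k(x·ξ) dω(ξ)`. -/
def ballBasis (d : ℕ) (Y : (j : ℕ) → Fin (harmonicDim d j) → S d → ℝ) (k j : ℕ)
    (i : Fin (harmonicDim d j)) (x : E d) : ℝ :=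
  v d k * ∫ ξ, Y j i ξ * (U d k).eval (inner ℝ x (ξ : E d)) ∂(surfaceMeasure d)

/-- The coefficient of `f` with respect to `P_{k,j,i}` in `L²(𝔹^d)`. -/
def coeffBall (d : ℕ) (Y : (j : ℕ) → Fin (harmonicDim d j) → S d → ℝ) (f : E d → ℝ) (k j : ℕ)
    (i : Fin (harmonicDim d j)) : ℝ :=
  ∫ x in unitBall d, f x * ballBasis d Y k j i x

/-- The index set `Ξ_k = {k, k-2, …, ε_k}`, with `ε_k ∈ {0, 1}` of the parity of `k`. -/
def parityIndices (k : ℕ) : Finset ℕ := (Finset.range (k + 1)).filter fun j => j % 2 = k % 2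

/-- The squared norm of the Sobolev space `H^r(L²(𝔹^d))`. -/
def normSqH (d : ℕ) (Y : (j : ℕ) → Fin (harmonicDim d j) → S d → ℝ) (r : ℝ) (f : E d → ℝ) : ℝ :=
  ∑' k : ℕ, ∑ j ∈ parityIndices k, ∑ i : Fin (harmonicDim d j),
    (((k : ℝ) + 1) ^ r * coeffBall d Y f k j i) ^ 2

/-- Membership in the Sobolev space `H^r(L²(𝔹^d))`: the function is in `L²(𝔹^d)` and the series
defining the squared norm converges. -/
def MemH (d : ℕ) (Y : (j : ℕ) → Fin (harmonicDim d j) → S d → ℝ) (r : ℝ) (f : E d → ℝ) : Prop :=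
  MemLp f 2 (volume.restrict (unitBall d)) ∧
    Summable fun k : ℕ => ∑ j ∈ parityIndices k, ∑ i : Fin (harmonicDim d j),
      (((k : ℝ) + 1) ^ r * coeffBall d Y f k j i) ^ 2

/-! ### Quadrature and ridge polynomials -/

/-- `(lam_ℓ, ξ_ℓ)`, `ℓ = 1, …, n`, is a quadrature rule on the sphere with positive weights that is
exact for all spherical polynomials of degree at most `m`. -/
structure IsQuadrature (d m n : ℕ) (lam : Fin n → ℝ) (ξ : Fin n → S d) : Prop where
  pos : ∀ l, 0 < lam l
  exact : ∀ q : MvPolynomial (Fin d) ℝ, q.totalDegree ≤ m →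
    ∫ η, polyFun q (η : E d) ∂(surfaceMeasure d) = ∑ l, lam l * polyFun q (ξ l : E d)

/-- The ridge polynomial in direction `ξ`,
`p(t) = ∑_{k=0}^s v_k² (∫_{𝔹^d} U_k(ξ·y) f(y) dy) U_k(t)`. -/
def ridgePoly (d s : ℕ) (f : E d → ℝ) (ξ : S d) : ℝ[X] :=
  ∑ k ∈ Finset.range (s + 1),
    C (v d k ^ 2 * ∫ y in unitBall d, (U d k).eval (inner ℝ (ξ : E d) y) * f y) * U d k

end RidgeBall

end

noncomputable section
namespace RidgeBall

/-! ### Linear forms, the squared norm and directional derivatives of polynomials -/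

/-! The proof rests on the reproducing formula `polyFun_eq_sum_integral`: for deg P ≤ s, P(x) =
∑_{k≤s} v_k² ∫ U_k(ξ·x) A_k(ξ) dω(ξ), where A_k(ξ) = ∫_𝔹 U_k(ξ·y) P(y) dy. On the sphere both
U_k(ξ·x) and A_k(ξ) agree with homogeneous polynomials of degree k in ξ
(`exists_isHomogeneous_gegenbauer`). Their product therefore has degree at most 2s, and the
quadrature rule replaces the integral by a sum without error. This sum is ∑ λ_ℓ p_ℓ(ξ_ℓ·x).

For the norm bound, the U_k-coefficient of p_ℓ is v_k² A_k(ξ_ℓ), and exactness for A_k² gives ∑ λ_ℓ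
‖p_ℓ‖² = ∑ (k+1)² v_k⁴ ∫ A_k² dω. Fubini and Parseval on the sphere identify the k-th block of the
H-norm as (k+1)^{d+1} v_k² ∫ A_k² dω. It remains to use v_k² ≤ c (k+1)^{d-1}.

The reproducing formula combines two roles of G_k^{d/2}. In d+2 variables it is a zonal harmonic,
and Lebesgue measure on 𝔹^d is, up to a constant, the projection of the surface measure of 𝕊^{d+1};
hence ridge polynomials of different degrees are orthogonal on the ball
(`ballInt_gegenbauer_mul_gegenbauer`). In d variables G_k - |x|² G_{k-2} is harmonic, so G_k^{d/2}
reproduces degree-k homogeneous polynomials on 𝕊^{d-1} up to a constant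
(`sphereInt_homGegenbauer_mul_eq_eval`). All integrals come from one integration by parts,
`sphereInt_X_mul`, and functionals obeying the same recursion are proportional. -/

@[simp]
lemma mvPolynomial_C_two {σ : Type*} : MvPolynomial.C (σ := σ) (2 : ℝ) = 2 :=
  map_ofNat MvPolynomial.C 2

/-- The linear form `x ↦ η · x`. -/
def linForm {D : ℕ} (η : Fin D → ℝ) : MvPolynomial (Fin D) ℝ :=
  ∑ i, MvPolynomial.C (η i) * MvPolynomial.X i

/-- The quadratic form `x ↦ |x|²`. -/
def quadForm (D : ℕ) : MvPolynomial (Fin D) ℝ := ∑ i, MvPolynomial.X i ^ 2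

/-- The directional derivative along `η`. -/
def dirDeriv {D : ℕ} (η : Fin D → ℝ) :
    Derivation ℝ (MvPolynomial (Fin D) ℝ) (MvPolynomial (Fin D) ℝ) :=
  ∑ i, η i • MvPolynomial.pderiv i

variable {D d : ℕ}

lemma dirDeriv_apply (η : Fin D → ℝ) (q : MvPolynomial (Fin D) ℝ) :
    dirDeriv η q = ∑ i, MvPolynomial.C (η i) * MvPolynomial.pderiv i q := by
  simp only [dirDeriv, ← Derivation.coeFnAddMonoidHom_apply, map_sum, Finset.sum_apply]
  simp [MvPolynomial.smul_eq_C_mul]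

lemma polyLaplacian_apply (q : MvPolynomial (Fin D) ℝ) :
    polyLaplacian D q = ∑ i, MvPolynomial.pderiv i (MvPolynomial.pderiv i q) := by
  simp [polyLaplacian]

lemma pderiv_linForm (η : Fin D → ℝ) (i : Fin D) :
    MvPolynomial.pderiv i (linForm η) = MvPolynomial.C (η i) := by
  simp [linForm, MvPolynomial.pderiv_X, Pi.single_apply]

lemma pderiv_quadForm (i : Fin D) :
    MvPolynomial.pderiv i (quadForm D) = 2 * MvPolynomial.X i := by
  simp [quadForm, MvPolynomial.pderiv_X, Pi.single_apply]

lemma dirDeriv_linForm {η : Fin D → ℝ} (hη : ∑ i, η i ^ 2 = 1) :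
    dirDeriv η (linForm η) = 1 := by
  rw [dirDeriv_apply]
  calc _ = MvPolynomial.C (∑ i, η i ^ 2) := by simp [pderiv_linForm, sq]
    _ = 1 := by rw [hη, map_one]

lemma dirDeriv_quadForm (η : Fin D → ℝ) :
    dirDeriv η (quadForm D) = 2 * linForm η := by
  rw [dirDeriv_apply, linForm, Finset.mul_sum]
  exact Finset.sum_congr rfl fun i _ => by rw [pderiv_quadForm]; ring

lemma linForm_isHomogeneous (η : Fin D → ℝ) : (linForm η).IsHomogeneous 1 :=
  MvPolynomial.IsHomogeneous.sum _ _ _ fun _ _ => MvPolynomial.isHomogeneous_C_mul_X _ _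

lemma quadForm_isHomogeneous : (quadForm D).IsHomogeneous 2 :=
  MvPolynomial.IsHomogeneous.sum _ _ _ fun _ _ => MvPolynomial.isHomogeneous_X_pow _ _

lemma pderiv_isHomogeneous_succ {m : ℕ} {q : MvPolynomial (Fin D) ℝ}
    (hq : q.IsHomogeneous (m + 1)) (i : Fin D) : (MvPolynomial.pderiv i q).IsHomogeneous m := by
  simpa using hq.pderiv (i := i)

lemma dirDeriv_isHomogeneous_succ {m : ℕ} {q : MvPolynomial (Fin D) ℝ}
    (hq : q.IsHomogeneous (m + 1)) (η : Fin D → ℝ) : (dirDeriv η q).IsHomogeneous m := by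
  rw [dirDeriv_apply]
  exact MvPolynomial.IsHomogeneous.sum _ _ _ fun i _ => (pderiv_isHomogeneous_succ hq i).C_mul _

lemma polyLaplacian_isHomogeneous {m : ℕ} {q : MvPolynomial (Fin D) ℝ}
    (hq : q.IsHomogeneous (m + 2)) : (polyLaplacian D q).IsHomogeneous m := by
  rw [polyLaplacian_apply]
  exact MvPolynomial.IsHomogeneous.sum _ _ _ fun i _ =>
    pderiv_isHomogeneous_succ (pderiv_isHomogeneous_succ hq i) i

lemma pderiv_of_isHomogeneous_zero {q : MvPolynomial (Fin D) ℝ}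
    (hq : q.IsHomogeneous 0) (i : Fin D) : MvPolynomial.pderiv i q = 0 := by
  rw [(MvPolynomial.totalDegree_eq_zero_iff_eq_C).1
    ((MvPolynomial.totalDegree_zero_iff_isHomogeneous _).2 hq), MvPolynomial.pderiv_C]

lemma polyLaplacian_of_isHomogeneous_le_one {m : ℕ} (hm : m ≤ 1) {q : MvPolynomial (Fin D) ℝ}
    (hq : q.IsHomogeneous m) : polyLaplacian D q = 0 := by
  rw [polyLaplacian_apply]
  refine Finset.sum_eq_zero fun i _ => ?_
  refine pderiv_of_isHomogeneous_zero ?_ i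
  have := hq.pderiv (i := i)
  rwa [Nat.sub_eq_zero_of_le hm] at this

/-- The commutator of two derivations is a derivation, so it is enough that it vanishes on the
variables. -/
lemma pderiv_comm (i j : Fin D) (q : MvPolynomial (Fin D) ℝ) :
    MvPolynomial.pderiv i (MvPolynomial.pderiv j q) =
      MvPolynomial.pderiv j (MvPolynomial.pderiv i q) := by
  have h : ⁅MvPolynomial.pderiv (R := ℝ) i, MvPolynomial.pderiv (R := ℝ) j⁆ = 0 := by
    refine MvPolynomial.derivation_ext fun k => ?_
    simp [Derivation.commutator_apply, MvPolynomial.pderiv_X, Pi.single_apply, apply_ite]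
  have := congrArg (fun δ => δ q) h
  simpa [Derivation.commutator_apply, sub_eq_zero] using this

lemma polyLaplacian_pderiv (i : Fin D) (q : MvPolynomial (Fin D) ℝ) :
    polyLaplacian D (MvPolynomial.pderiv i q) = MvPolynomial.pderiv i (polyLaplacian D q) := by
  simp only [polyLaplacian_apply, map_sum]
  exact Finset.sum_congr rfl fun j _ => by rw [pderiv_comm j i, pderiv_comm j i]

lemma polyLaplacian_dirDeriv (η : Fin D → ℝ) (q : MvPolynomial (Fin D) ℝ) :
    polyLaplacian D (dirDeriv η q) = dirDeriv η (polyLaplacian D q) := by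
  simp only [dirDeriv_apply, map_sum, ← MvPolynomial.smul_eq_C_mul, map_smul, polyLaplacian_pderiv]

lemma polyLaplacian_mul (p q : MvPolynomial (Fin D) ℝ) :
    polyLaplacian D (p * q) = polyLaplacian D p * q
      + 2 * ∑ i, MvPolynomial.pderiv i p * MvPolynomial.pderiv i q + p * polyLaplacian D q := by
  simp only [polyLaplacian_apply, Finset.sum_mul, Finset.mul_sum, ← Finset.sum_add_distrib]
  refine Finset.sum_congr rfl fun i _ => ?_
  simp only [MvPolynomial.pderiv_mul, map_add]
  ring

lemma polyLaplacian_linForm_mul (η : Fin D → ℝ) (q : MvPolynomial (Fin D) ℝ) :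
    polyLaplacian D (linForm η * q) = 2 * dirDeriv η q + linForm η * polyLaplacian D q := by
  rw [polyLaplacian_mul, polyLaplacian_of_isHomogeneous_le_one le_rfl (linForm_isHomogeneous η),
    dirDeriv_apply]
  simp only [pderiv_linForm, zero_mul, zero_add]

lemma polyLaplacian_quadForm : polyLaplacian D (quadForm D) = 2 * (D : MvPolynomial (Fin D) ℝ) := by
  simp only [polyLaplacian_apply, pderiv_quadForm, ← mvPolynomial_C_two,
    MvPolynomial.pderiv_C_mul]
  simp [mul_comm]

lemma polyLaplacian_quadForm_mul {m : ℕ} {q : MvPolynomial (Fin D) ℝ} (hq : q.IsHomogeneous m) :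
    polyLaplacian D (quadForm D * q) =
      (2 * (D : MvPolynomial (Fin D) ℝ) + 4 * (m : MvPolynomial (Fin D) ℝ)) * q
        + quadForm D * polyLaplacian D q := by
  have := hq.sum_X_mul_pderiv
  rw [nsmul_eq_mul] at this
  rw [polyLaplacian_mul, polyLaplacian_quadForm]
  simp only [pderiv_quadForm, mul_assoc, ← Finset.mul_sum, this]
  ring

/-! ### Homogenised Gegenbauer polynomials -/

/-- The homogeneous polynomial `|x|^m G_m^ν(η · x / |x|)`. -/
def homGegenbauer (ν : ℝ) (η : Fin D → ℝ) : ℕ → MvPolynomial (Fin D) ℝ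
  | 0 => 1
  | 1 => MvPolynomial.C (2 * ν) * linForm η
  | m + 2 => MvPolynomial.C (((m : ℝ) + 2)⁻¹) *
      (MvPolynomial.C (2 * ((m : ℝ) + 1 + ν)) * linForm η * homGegenbauer ν η (m + 1)
        - MvPolynomial.C ((m : ℝ) + 2 * ν) * quadForm D * homGegenbauer ν η m)

lemma homGegenbauer_rec (ν : ℝ) (η : Fin D → ℝ) (m : ℕ) :
    ((m : MvPolynomial (Fin D) ℝ) + 2) * homGegenbauer ν η (m + 2) =
      2 * ((m : MvPolynomial (Fin D) ℝ) + 1 + MvPolynomial.C ν) * linForm η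
          * homGegenbauer ν η (m + 1)
        - ((m : MvPolynomial (Fin D) ℝ) + 2 * MvPolynomial.C ν) * quadForm D
          * homGegenbauer ν η m := by
  have h : ((m : MvPolynomial (Fin D) ℝ) + 2) * MvPolynomial.C (((m : ℝ) + 2)⁻¹) = 1 := by
    have : ((m : MvPolynomial (Fin D) ℝ) + 2) = MvPolynomial.C ((m : ℝ) + 2) := by simp
    rw [this, ← map_mul, mul_inv_cancel₀ (by positivity), map_one]
  rw [homGegenbauer, ← mul_assoc, h, one_mul]
  simp

lemma homGegenbauer_isHomogeneous (ν : ℝ) (η : Fin D → ℝ) (m : ℕ) :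
    (homGegenbauer ν η m).IsHomogeneous m := by
  induction m using Nat.twoStepInduction with
  | zero => exact MvPolynomial.isHomogeneous_one _ _
  | one => exact (linForm_isHomogeneous η).C_mul _
  | more m h0 h1 =>
    refine MvPolynomial.IsHomogeneous.C_mul (.sub ?_ ?_) _
    · have := ((linForm_isHomogeneous η).C_mul (2 * ((m : ℝ) + 1 + ν))).mul h1
      rwa [show 1 + (m + 1) = m + 2 by ring] at this
    · have := ((quadForm_isHomogeneous (D := D)).C_mul ((m : ℝ) + 2 * ν)).mul h0
      rwa [add_comm 2 m] at this

lemma natCast_add_ne_zero (m k : ℕ) :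
    (m : MvPolynomial (Fin D) ℝ) + ((k + 1 : ℕ) : MvPolynomial (Fin D) ℝ) ≠ 0 := by
  exact_mod_cast (Nat.succ_ne_zero (m + k))

/-- Differentiating the three-term recurrence leaves |x|² times the derivative of G_m, which the
previous recurrence rewrites through G_m and G_{m+1}. In `key` this is a separate hypothesis
carrying the factor m + 2ν, so that the base case m = 0, which has no predecessor, fits the same
computation. -/
lemma dirDeriv_homGegenbauer_succ (ν : ℝ) {η : Fin D → ℝ} (hη : ∑ i, η i ^ 2 = 1) (m : ℕ) :
    dirDeriv η (homGegenbauer ν η (m + 1)) =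
      ((m : MvPolynomial (Fin D) ℝ) + 2 * MvPolynomial.C ν) * homGegenbauer ν η m := by
  have key : ∀ m, dirDeriv η (homGegenbauer ν η (m + 1)) =
        ((m : MvPolynomial (Fin D) ℝ) + 2 * MvPolynomial.C ν) * homGegenbauer ν η m →
      ((m : MvPolynomial (Fin D) ℝ) + 2 * MvPolynomial.C ν) * quadForm D
        * dirDeriv η (homGegenbauer ν η m) =
      ((m : MvPolynomial (Fin D) ℝ) + 2 * MvPolynomial.C ν) *
        (2 * ((m : MvPolynomial (Fin D) ℝ) + MvPolynomial.C ν) * linForm η * homGegenbauer ν η m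
         - ((m : MvPolynomial (Fin D) ℝ) + 1) * homGegenbauer ν η (m + 1)) →
      dirDeriv η (homGegenbauer ν η (m + 2)) =
        (((m + 1 : ℕ) : MvPolynomial (Fin D) ℝ) + 2 * MvPolynomial.C ν)
          * homGegenbauer ν η (m + 1) := by
    intro m h1 h0
    refine mul_left_cancel₀ (natCast_add_ne_zero (D := D) m 1) ?_
    have hr := congrArg (dirDeriv η) (homGegenbauer_rec ν η m)
    simp only [Derivation.leibniz, map_sub, map_add, Derivation.map_natCast, smul_eq_mul,
      dirDeriv_linForm hη, dirDeriv_quadForm, h1] at hr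
    have hC : dirDeriv η (MvPolynomial.C ν) = 0 := (dirDeriv η).map_algebraMap ν
    have h2 : dirDeriv η (2 : MvPolynomial (Fin D) ℝ) = 0 := by
      exact_mod_cast (dirDeriv η).map_natCast 2
    have h3 : dirDeriv η (1 : MvPolynomial (Fin D) ℝ) = 0 := (dirDeriv η).map_one_eq_zero
    simp only [hC, h2, h3] at hr
    push_cast
    linear_combination hr - h0
  induction m using Nat.twoStepInduction with
  | zero =>
    simp only [homGegenbauer]
    rw [Derivation.leibniz, dirDeriv_linForm hη,
      show dirDeriv η (MvPolynomial.C (2 * ν)) = 0 from (dirDeriv η).map_algebraMap _]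
    simp
  | one =>
    refine key 0 ?_ ?_
    · simp only [homGegenbauer]
      rw [Derivation.leibniz, dirDeriv_linForm hη,
        show dirDeriv η (MvPolynomial.C (2 * ν)) = 0 from (dirDeriv η).map_algebraMap _]
      simp
    · simp [homGegenbauer]
  | more m h0 h1 =>
    refine key (m + 1) h1 ?_
    have hr := homGegenbauer_rec ν η m
    rw [h0]
    push_cast
    linear_combination (((m : MvPolynomial (Fin D) ℝ) + 1 + 2 * MvPolynomial.C ν)) * hr

lemma polyLaplacian_homGegenbauer_rec (ν : ℝ) {η : Fin D → ℝ} (hη : ∑ i, η i ^ 2 = 1) (m : ℕ) :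
    ((m : MvPolynomial (Fin D) ℝ) + 2) * polyLaplacian D (homGegenbauer ν η (m + 2)) =
      2 * ((m : MvPolynomial (Fin D) ℝ) + 1 + MvPolynomial.C ν) *
        (2 * (((m : MvPolynomial (Fin D) ℝ) + 2 * MvPolynomial.C ν) * homGegenbauer ν η m)
          + linForm η * polyLaplacian D (homGegenbauer ν η (m + 1)))
        - ((m : MvPolynomial (Fin D) ℝ) + 2 * MvPolynomial.C ν) *
        ((2 * (D : MvPolynomial (Fin D) ℝ) + 4 * (m : MvPolynomial (Fin D) ℝ)) *
            homGegenbauer ν η m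
          + quadForm D * polyLaplacian D (homGegenbauer ν η m)) := by
  have hC : ∀ (r : ℝ) (q : MvPolynomial (Fin D) ℝ),
      polyLaplacian D (MvPolynomial.C r * q) = MvPolynomial.C r * polyLaplacian D q := by
    intro r q
    rw [← MvPolynomial.smul_eq_C_mul, map_smul, MvPolynomial.smul_eq_C_mul]
  have e1 : ((m : MvPolynomial (Fin D) ℝ) + 2) = MvPolynomial.C ((m : ℝ) + 2) := by simp
  have e2 : 2 * ((m : MvPolynomial (Fin D) ℝ) + 1 + MvPolynomial.C ν)
      = MvPolynomial.C (2 * ((m : ℝ) + 1 + ν)) := by simp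
  have e3 : (m : MvPolynomial (Fin D) ℝ) + 2 * MvPolynomial.C ν
      = MvPolynomial.C ((m : ℝ) + 2 * ν) := by simp
  have hr := congrArg (polyLaplacian D) (homGegenbauer_rec ν η m)
  have hd := dirDeriv_homGegenbauer_succ ν hη m
  rw [e1, e2, e3, map_sub, hC, mul_assoc, mul_assoc, hC, hC, polyLaplacian_linForm_mul,
    polyLaplacian_quadForm_mul (homGegenbauer_isHomogeneous ν η m), hd, e3] at hr
  rw [e1, e2, e3, hr]

/-- For `D = 2ν + 2` the homogenised Gegenbauer polynomials are harmonic. -/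
lemma polyLaplacian_homGegenbauer_of_add_two {ν : ℝ} (hν : (D : ℝ) = 2 * ν + 2)
    {η : Fin D → ℝ} (hη : ∑ i, η i ^ 2 = 1) (m : ℕ) :
    polyLaplacian D (homGegenbauer ν η m) = 0 := by
  have hD : (D : MvPolynomial (Fin D) ℝ) = 2 * MvPolynomial.C ν + 2 := by
    have := congrArg (MvPolynomial.C (σ := Fin D)) hν
    simpa using this
  induction m using Nat.twoStepInduction with
  | zero =>
    exact polyLaplacian_of_isHomogeneous_le_one zero_le_one (homGegenbauer_isHomogeneous ν η 0)
  | one => exact polyLaplacian_of_isHomogeneous_le_one le_rfl (homGegenbauer_isHomogeneous ν η 1)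
  | more m h0 h1 =>
    -- Only the terms in G_m survive, with coefficients 4(m+1+ν)(m+2ν) and (m+2ν)(2D+4m); these
    -- agree when D = 2ν + 2.
    refine mul_left_cancel₀ (natCast_add_ne_zero (D := D) m 1) ?_
    have := polyLaplacian_homGegenbauer_rec ν hη m
    rw [h0, h1, hD] at this
    push_cast
    linear_combination this

/-- The homogenisation of the derivative of the Gegenbauer polynomials. -/
def homGegenbauerDeriv (ν : ℝ) (η : Fin D → ℝ) : ℕ → MvPolynomial (Fin D) ℝ
  | 0 => 0
  | m + 1 => ((m : MvPolynomial (Fin D) ℝ) + 2 * MvPolynomial.C ν) * homGegenbauer ν η m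
      + linForm η * homGegenbauerDeriv ν η m

/-- Homogenised form of n G_n = t G_n' - G_{n-1}', the second classical derivative identity; the
first one, G_{n+1}' = (n+2ν) G_n + t G_n', is the definition of `homGegenbauerDeriv`. -/
lemma succ_mul_homGegenbauer_succ (ν : ℝ) (η : Fin D → ℝ) (m : ℕ) :
    ((m : MvPolynomial (Fin D) ℝ) + 1) * homGegenbauer ν η (m + 1) =
      linForm η * homGegenbauerDeriv ν η (m + 1) - quadForm D * homGegenbauerDeriv ν η m := by
  induction m with
  | zero => simp [homGegenbauerDeriv, homGegenbauer]; ring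
  | succ m ih =>
    have hr := homGegenbauer_rec ν η m
    rw [homGegenbauerDeriv] at ih ⊢
    rw [homGegenbauerDeriv.eq_2 ν η m]
    push_cast
    linear_combination hr + linForm η * ih

/-- In dimension 2ν the homogenised G_m are no longer harmonic. Knowing the Laplacian exactly shows
that subtracting |x|² G_m from G_{m+2} repairs this. -/
lemma polyLaplacian_homGegenbauer_succ {ν : ℝ} (hν : (D : ℝ) = 2 * ν)
    {η : Fin D → ℝ} (hη : ∑ i, η i ^ 2 = 1) (m : ℕ) :
    polyLaplacian D (homGegenbauer ν η (m + 1)) = 2 * homGegenbauerDeriv ν η m := by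
  have hD : (D : MvPolynomial (Fin D) ℝ) = 2 * MvPolynomial.C ν := by
    have := congrArg (MvPolynomial.C (σ := Fin D)) hν
    simpa using this
  have hz : polyLaplacian D (homGegenbauer ν η 0) = 0 :=
    polyLaplacian_of_isHomogeneous_le_one zero_le_one (homGegenbauer_isHomogeneous ν η 0)
  have ho : polyLaplacian D (homGegenbauer ν η 1) = 0 :=
    polyLaplacian_of_isHomogeneous_le_one le_rfl (homGegenbauer_isHomogeneous ν η 1)
  induction m using Nat.twoStepInduction with
  | zero => rw [ho]; simp [homGegenbauerDeriv]
  | one =>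
    refine mul_left_cancel₀ (natCast_add_ne_zero (D := D) 0 1) ?_
    have := polyLaplacian_homGegenbauer_rec ν hη 0
    rw [hz, ho, hD] at this
    simp only [homGegenbauerDeriv, homGegenbauer] at this ⊢
    push_cast at this ⊢
    linear_combination this
  | more m h0 h1 =>
    refine mul_left_cancel₀ (natCast_add_ne_zero (D := D) (m + 1) 1) ?_
    have := polyLaplacian_homGegenbauer_rec ν hη (m + 1)
    rw [h0, h1, hD] at this
    have ha := succ_mul_homGegenbauer_succ ν η m
    rw [homGegenbauerDeriv]
    push_cast at this ⊢
    linear_combination this - 2 * ((m : MvPolynomial (Fin D) ℝ) + 1 + 2 * MvPolynomial.C ν) * ha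

/-- For `D = 2ν`, differences of homogenised Gegenbauer polynomials are harmonic. -/
lemma polyLaplacian_homGegenbauer_sub {ν : ℝ} (hν : (D : ℝ) = 2 * ν)
    {η : Fin D → ℝ} (hη : ∑ i, η i ^ 2 = 1) (m : ℕ) :
    polyLaplacian D (homGegenbauer ν η (m + 2) - quadForm D * homGegenbauer ν η m) = 0 := by
  have hD : (D : MvPolynomial (Fin D) ℝ) = 2 * MvPolynomial.C ν := by
    have := congrArg (MvPolynomial.C (σ := Fin D)) hν
    simpa using this
  rw [map_sub, polyLaplacian_homGegenbauer_succ hν hη,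
    polyLaplacian_quadForm_mul (homGegenbauer_isHomogeneous ν η m), hD]
  cases m with
  | zero =>
    rw [polyLaplacian_of_isHomogeneous_le_one zero_le_one (homGegenbauer_isHomogeneous ν η 0)]
    simp [homGegenbauerDeriv]; ring
  | succ m =>
    rw [polyLaplacian_homGegenbauer_succ hν hη]
    have ha := succ_mul_homGegenbauer_succ ν η m
    rw [homGegenbauerDeriv]
    push_cast
    linear_combination -2 * ha

/-! ### Integrals of homogeneous polynomials in polar coordinates -/

instance : IsFiniteMeasure (surfaceMeasure D) := by unfold surfaceMeasure; infer_instance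

lemma continuous_polyFun (q : MvPolynomial (Fin D) ℝ) : Continuous (polyFun q) :=
  (MvPolynomial.continuous_eval q).comp (by fun_prop)

@[simp] lemma polyFun_add (p q : MvPolynomial (Fin D) ℝ) (x : E D) :
    polyFun (p + q) x = polyFun p x + polyFun q x := map_add _ _ _

@[simp] lemma polyFun_sub (p q : MvPolynomial (Fin D) ℝ) (x : E D) :
    polyFun (p - q) x = polyFun p x - polyFun q x := map_sub _ _ _

@[simp] lemma polyFun_mul (p q : MvPolynomial (Fin D) ℝ) (x : E D) :
    polyFun (p * q) x = polyFun p x * polyFun q x := map_mul _ _ _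

@[simp] lemma polyFun_sum {ι : Type*} (s : Finset ι) (p : ι → MvPolynomial (Fin D) ℝ) (x : E D) :
    polyFun (∑ i ∈ s, p i) x = ∑ i ∈ s, polyFun (p i) x := map_sum _ _ _

@[simp] lemma polyFun_C (c : ℝ) (x : E D) :
    polyFun (MvPolynomial.C c : MvPolynomial (Fin D) ℝ) x = c := MvPolynomial.eval_C _

@[simp] lemma polyFun_one (x : E D) : polyFun (1 : MvPolynomial (Fin D) ℝ) x = 1 := map_one _

@[simp] lemma polyFun_X (i : Fin D) (x : E D) :
    polyFun (MvPolynomial.X i : MvPolynomial (Fin D) ℝ) x = x i := MvPolynomial.eval_X _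

@[simp] lemma polyFun_smul (c : ℝ) (q : MvPolynomial (Fin D) ℝ) (x : E D) :
    polyFun (c • q) x = c * polyFun q x := by
  rw [MvPolynomial.smul_eq_C_mul, polyFun_mul, polyFun_C]

lemma polyFun_linForm (η : Fin D → ℝ) (x : E D) : polyFun (linForm η) x = ∑ i, η i * x i := by
  simp [linForm]

lemma polyFun_quadForm (x : E D) : polyFun (quadForm D) x = ‖x‖ ^ 2 := by
  simp [quadForm, EuclideanSpace.norm_sq_eq, polyFun]

lemma polyFun_quadForm_sphere (x : S D) : polyFun (quadForm D) (x : E D) = 1 := by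
  rw [polyFun_quadForm, norm_eq_of_mem_sphere]; norm_num

lemma polyFun_smul_of_isHomogeneous {m : ℕ} {q : MvPolynomial (Fin D) ℝ} (hq : q.IsHomogeneous m)
    (r : ℝ) (x : E D) : polyFun q (r • x) = r ^ m * polyFun q x := by
  simp only [polyFun, MvPolynomial.eval_eq, Finset.mul_sum]
  refine Finset.sum_congr rfl fun a ha => ?_
  have h := hq.degree_eq_sum_deg_support ha
  simp only [PiLp.smul_apply, smul_eq_mul, mul_pow, Finset.prod_mul_distrib,
    Finset.prod_pow_eq_pow_sum]
  rw [show ∑ i ∈ a.support, a i = m from h.symm]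
  ring

lemma hasFDerivAt_polyFun (q : MvPolynomial (Fin D) ℝ) (x : E D) :
    HasFDerivAt (polyFun q)
      (∑ i, polyFun (MvPolynomial.pderiv i q) x • (EuclideanSpace.proj i : E D →L[ℝ] ℝ)) x := by
  induction q using MvPolynomial.induction_on with
  | C a =>
    have : polyFun (MvPolynomial.C a : MvPolynomial (Fin D) ℝ) = fun _ => a := by ext; simp
    rw [this]
    refine (hasFDerivAt_const a x).congr_fderiv ?_
    simp [polyFun]
  | add p q hp hq =>
    have : polyFun (p + q) = polyFun p + polyFun q := by ext; simp
    rw [this]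
    refine (hp.add hq).congr_fderiv ?_
    simp [add_smul, Finset.sum_add_distrib]
  | mul_X p j hp =>
    have : polyFun (p * MvPolynomial.X j) = polyFun p * ⇑(EuclideanSpace.proj j : E D →L[ℝ] ℝ) := by
      ext; simp
    rw [this]
    refine (hp.mul (EuclideanSpace.proj j : E D →L[ℝ] ℝ).hasFDerivAt).congr_fderiv ?_
    ext y
    have h : ∀ i, polyFun (MvPolynomial.pderiv i (p * MvPolynomial.X j)) x * y i =
        x j * (polyFun (MvPolynomial.pderiv i p) x * y i)
          + if j = i then polyFun p x * y j else 0 := by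
      intro i
      rw [MvPolynomial.pderiv_mul, polyFun_add, polyFun_mul, polyFun_mul, polyFun_X,
        MvPolynomial.pderiv_X, Pi.single_apply]
      split_ifs with hij
      · subst hij; simp; ring
      · simp [polyFun]; ring
    have h' : ∀ q : Fin D → ℝ,
        (∑ i, q i • (EuclideanSpace.proj i : E D →L[ℝ] ℝ)) y = ∑ i, q i * y i := by
      intro q; simp
    rw [h', add_apply, smul_apply, smul_apply, h', Finset.sum_congr rfl fun i _ => h i]
    simp [Finset.sum_add_distrib, Finset.mul_sum, add_comm]

lemma fderiv_polyFun_single (q : MvPolynomial (Fin D) ℝ) (x : E D) (i : Fin D) :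
    fderiv ℝ (polyFun q) x (EuclideanSpace.single i 1) = polyFun (MvPolynomial.pderiv i q) x := by
  rw [(hasFDerivAt_polyFun q x).fderiv]
  simp []

/-- The integral of polynomials over the unit sphere. -/
def sphereInt (D : ℕ) : MvPolynomial (Fin D) ℝ →ₗ[ℝ] ℝ where
  toFun q := ∫ ξ, polyFun q (ξ : E D) ∂(surfaceMeasure D)
  map_add' p q := by
    simp only [polyFun_add]
    exact integral_add
      (((continuous_polyFun p).comp continuous_subtype_val).integrable_of_hasCompactSupport
        (HasCompactSupport.of_compactSpace _))
      (((continuous_polyFun q).comp continuous_subtype_val).integrable_of_hasCompactSupport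
        (HasCompactSupport.of_compactSpace _))
  map_smul' c q := by simp [integral_const_mul]

lemma sphereInt_apply (q : MvPolynomial (Fin D) ℝ) :
    sphereInt D q = ∫ ξ, polyFun q (ξ : E D) ∂(surfaceMeasure D) := rfl

lemma sphereInt_C_mul (c : ℝ) (q : MvPolynomial (Fin D) ℝ) :
    sphereInt D (MvPolynomial.C c * q) = c * sphereInt D q := by
  rw [← MvPolynomial.smul_eq_C_mul, map_smul, smul_eq_mul]

lemma sphereInt_quadForm_mul (q : MvPolynomial (Fin D) ℝ) :
    sphereInt D (quadForm D * q) = sphereInt D q := by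
  simp [sphereInt_apply, polyFun_quadForm_sphere]

/-- Homogeneity separates the variables in polar coordinates. This is the bridge between integrals
over the whole space and over the sphere. -/
lemma integral_radial_mul_polyFun (hD : 1 ≤ D) (φ : ℝ → ℝ) {m : ℕ} {q : MvPolynomial (Fin D) ℝ}
    (hq : q.IsHomogeneous m) :
    ∫ x : E D, φ ‖x‖ * polyFun q x =
      (∫ r in Set.Ioi (0 : ℝ), r ^ (D - 1 + m) * φ r) * sphereInt D q := by
  have hdim : Module.finrank ℝ (E D) = D := by simp
  have : Nontrivial (E D) := Module.nontrivial_of_finrank_pos (R := ℝ) (by rw [hdim]; exact hD)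
  calc ∫ x : E D, φ ‖x‖ * polyFun q x
      = ∫ x : ({(0 : E D)}ᶜ : Set (E D)), φ ‖x.1‖ * polyFun q x.1
          ∂((volume : Measure (E D)).comap Subtype.val) := by
        rw [integral_subtype_comap (measurableSet_singleton _).compl
          fun x : E D => φ ‖x‖ * polyFun q x, restrict_compl_singleton]
    _ = ∫ p, polyFun q (p.1 : E D) * (φ p.2 * (p.2 : ℝ) ^ m)
          ∂((volume : Measure (E D)).toSphere.prod (.volumeIoiPow (D - 1))) := by
        have := (volume : Measure (E D)).measurePreserving_homeomorphUnitSphereProd.integral_comp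
          (Homeomorph.measurableEmbedding _)
          (fun p : S D × Set.Ioi (0 : ℝ) => polyFun q (p.1 : E D) * (φ p.2 * (p.2 : ℝ) ^ m))
        rw [hdim] at this
        rw [← this]
        refine integral_congr_ae (.of_forall fun x => ?_)
        have hx : ‖x.1‖ ≠ 0 := norm_ne_zero_iff.2 x.2
        have hx' : x.1 = ‖x.1‖ • (‖x.1‖⁻¹ • x.1) := by
          rw [smul_smul, mul_inv_cancel₀ hx, one_smul]
        have h2 := polyFun_smul_of_isHomogeneous hq ‖x.1‖ (‖x.1‖⁻¹ • x.1)
        rw [← hx'] at h2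
        simp only [homeomorphUnitSphereProd_apply_snd_coe, homeomorphUnitSphereProd_apply_fst_coe]
        rw [h2]
        ring
    _ = sphereInt D q * ∫ r : Set.Ioi (0 : ℝ), φ r * (r : ℝ) ^ m ∂(.volumeIoiPow (D - 1)) :=
        integral_prod_mul (fun ξ : S D => polyFun q (ξ : E D))
          (fun r : Set.Ioi (0 : ℝ) => φ r * (r : ℝ) ^ m)
    _ = _ := by
        rw [mul_comm]
        congr 1
        simp only [Measure.volumeIoiPow, ENNReal.ofReal]
        rw [integral_withDensity_eq_integral_smul
          ((measurable_subtype_coe.pow_const _).real_toNNReal),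
          integral_subtype_comap measurableSet_Ioi
            fun a : ℝ => Real.toNNReal (a ^ (D - 1)) • (φ a * a ^ m)]
        refine setIntegral_congr_fun measurableSet_Ioi fun x hx => ?_
        rw [NNReal.smul_def, Real.coe_toNNReal _ (pow_nonneg (le_of_lt hx) _), smul_eq_mul, pow_add]
        ring

lemma integral_unitBall_polyFun (hD : 1 ≤ D) {m : ℕ} {q : MvPolynomial (Fin D) ℝ}
    (hq : q.IsHomogeneous m) :
    ∫ x in unitBall D, polyFun q x = sphereInt D q / (m + D) := by
  have h := integral_radial_mul_polyFun hD (Set.indicator (Set.Iic 1) 1) hq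
  have h1 : ∫ x : E D, Set.indicator (Set.Iic 1) 1 ‖x‖ * polyFun q x
      = ∫ x in unitBall D, polyFun q x := by
    rw [← integral_indicator (by exact Metric.isClosed_closedBall.measurableSet)]
    congr 1 with x
    by_cases hx : ‖x‖ ≤ 1 <;> simp [Set.indicator, unitBall, hx]
  have h2 : ∫ r in Set.Ioi (0 : ℝ), r ^ (D - 1 + m) * Set.indicator (Set.Iic 1) 1 r
      = 1 / (m + D) := by
    have : ∀ r : ℝ, r ^ (D - 1 + m) * Set.indicator (Set.Iic 1) 1 r
        = Set.indicator (Set.Iic 1) (fun r => r ^ (D - 1 + m)) r := by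
      intro r; by_cases hr : r ≤ 1 <;> simp [Set.indicator, hr]
    simp only [this]
    rw [setIntegral_indicator measurableSet_Iic, Set.Ioi_inter_Iic,
      ← intervalIntegral.integral_of_le zero_le_one, integral_pow]
    have : ((D - 1 + m : ℕ) : ℝ) + 1 = m + D := by
      push_cast [Nat.cast_sub hD]; ring
    rw [this]; simp
  rw [← h1, h, h2]; ring

/-! ### Radial cut-offs and integration by parts on the sphere -/

lemma _root_.HasCompactSupport.comp_norm_sq {V : Type*} [NormedAddCommGroup V] [ProperSpace V]
    {g : ℝ → ℝ} (hg : HasCompactSupport g) : HasCompactSupport fun x : V => g (‖x‖ ^ 2) := by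
  obtain ⟨R, hR⟩ := hg.isCompact.isBounded.subset_closedBall 0
  refine HasCompactSupport.intro (isCompact_closedBall (0 : V) (max R 1)) fun r hr => ?_
  by_contra hne
  have h1 := hR (subset_tsupport _ (Function.mem_support.2 hne))
  simp only [mem_closedBall_zero_iff, Real.norm_eq_abs, abs_pow, not_le, abs_norm] at h1 hr
  nlinarith [le_max_left R 1, le_max_right R 1]

/-- Integration by parts of r^{n+1} f(r²) on the half-line. The argument r² matches the cut-off
b(|x|²), which is differentiable at the origin. -/
lemma integral_pow_succ_mul_deriv {f : ℝ → ℝ} (hf : ContDiff ℝ 1 f) (hc : HasCompactSupport f)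
    (n : ℕ) :
    ∫ r in Set.Ioi (0 : ℝ), r ^ (n + 2) * (2 * deriv f (r ^ 2)) =
      -((n + 1) * ∫ r in Set.Ioi (0 : ℝ), r ^ n * f (r ^ 2)) := by
  have hf' : Continuous (deriv f) := hf.continuous_deriv le_rfl
  have hcomp : ∀ {g : ℝ → ℝ}, HasCompactSupport g → HasCompactSupport fun r : ℝ => g (r ^ 2) :=
    fun hg => by simpa using hg.comp_norm_sq (V := ℝ)
  have i1 : Integrable fun r : ℝ => r ^ n * f (r ^ 2) :=
    Continuous.integrable_of_hasCompactSupport (by have := hf.continuous; fun_prop)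
      (hcomp hc).mul_left
  have i2 : Integrable fun r : ℝ => r ^ (n + 2) * (2 * deriv f (r ^ 2)) :=
    Continuous.integrable_of_hasCompactSupport (by fun_prop)
      (HasCompactSupport.mul_left (HasCompactSupport.mul_left (hcomp hc.deriv)))
  have hd : ∀ r ∈ Set.Ici (0 : ℝ), HasDerivAt (fun r : ℝ => r ^ (n + 1) * f (r ^ 2))
      ((n + 1) * (r ^ n * f (r ^ 2)) + r ^ (n + 2) * (2 * deriv f (r ^ 2))) r := by
    intro r _
    have h1 : HasDerivAt f (deriv f (r ^ 2)) (r ^ 2) :=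
      ((hf.differentiable one_ne_zero) (r ^ 2)).hasDerivAt
    have h2 : HasDerivAt (fun r : ℝ => r ^ 2) (2 * r) r := by simpa using hasDerivAt_pow 2 r
    have h3 := (hasDerivAt_pow (n + 1) r).mul (HasDerivAt.comp (h₂ := f) (h := fun r : ℝ => r ^ 2) r h1 h2)
    refine h3.congr_deriv ?_
    simp only [Function.comp, Nat.add_sub_cancel]
    push_cast
    ring
  have ht : Filter.Tendsto (fun r : ℝ => r ^ (n + 1) * f (r ^ 2)) Filter.atTop (nhds 0) := by
    have := (hcomp hc).mul_left (f := fun r : ℝ => r ^ (n + 1))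
    exact this.is_zero_at_infty.mono_left atTop_le_cocompact
  have h := integral_Ioi_of_hasDerivAt_of_tendsto' hd
    ((i1.const_mul _).add i2).integrableOn ht
  rw [integral_add (i1.const_mul _).integrableOn i2.integrableOn, integral_const_mul] at h
  simp at h
  linarith

lemma integral_pow_mul_pos {b : ℝ → ℝ} (hb : Continuous b) (hbc : HasCompactSupport b)
    (hb0 : ∀ r, 0 ≤ b r) (hb1 : ∀ r, |r| ≤ 1 → b r = 1) (n : ℕ) :
    0 < ∫ r in Set.Ioi (0 : ℝ), r ^ n * b (r ^ 2) := by
  have hbc' : HasCompactSupport fun r : ℝ => b (r ^ 2) := by simpa using hbc.comp_norm_sq (V := ℝ)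
  have hn : ∀ r ∈ Set.Ioi (0 : ℝ), 0 ≤ r ^ n * b (r ^ 2) := fun r hr =>
    mul_nonneg (pow_nonneg (le_of_lt hr) _) (hb0 _)
  have hint : Integrable fun r : ℝ => r ^ n * b (r ^ 2) :=
    Continuous.integrable_of_hasCompactSupport (by fun_prop) (HasCompactSupport.mul_left hbc')
  rw [setIntegral_pos_iff_support_of_nonneg_ae
    (by filter_upwards [ae_restrict_mem measurableSet_Ioi] with r hr using hn r hr)
    hint.integrableOn]
  refine lt_of_lt_of_le ?_ (measure_mono (s := Set.Ioo 0 1) fun r hr => ⟨?_, hr.1⟩)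
  · simp
  · have : |r ^ 2| ≤ 1 := by rw [abs_of_nonneg (sq_nonneg _)]; nlinarith [hr.1, hr.2]
    simp [hb1 _ this, hr.1.ne']

lemma sphereInt_X (hD : 1 ≤ D) (i : Fin D) : sphereInt D (MvPolynomial.X i) = 0 := by
  have h := integral_unitBall_polyFun hD (MvPolynomial.isHomogeneous_X ℝ i)
  have h0 : ∫ x in unitBall D, polyFun (MvPolynomial.X i) x = 0 := by
    rw [← integral_indicator (by exact Metric.isClosed_closedBall.measurableSet)]
    have := integral_neg_eq_self (fun x : E D =>
      (unitBall D).indicator (polyFun (MvPolynomial.X i)) x) volume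
    have h2 : ∀ x : E D, (unitBall D).indicator (polyFun (MvPolynomial.X i)) (-x)
        = - (unitBall D).indicator (polyFun (MvPolynomial.X i)) x := by
      intro x; by_cases hx : ‖x‖ ≤ 1 <;> simp [Set.indicator, unitBall, hx]
    simp only [h2, integral_neg] at this
    linarith
  rw [h0] at h
  have : (((1 : ℕ) : ℝ) + D) ≠ 0 := by positivity
  field_simp at h
  linarith

/-- Integration by parts on the sphere. -/
lemma sphereInt_X_mul (hD : 1 ≤ D) {m : ℕ} {q : MvPolynomial (Fin D) ℝ}
    (hq : q.IsHomogeneous m) (i : Fin D) :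
    ((m : ℝ) + D - 1) * sphereInt D (MvPolynomial.X i * q) =
      sphereInt D (MvPolynomial.pderiv i q) := by
  cases m with
  | zero =>
    rw [MvPolynomial.totalDegree_eq_zero_iff_eq_C.1
      ((MvPolynomial.totalDegree_zero_iff_isHomogeneous _).2 hq), mul_comm (MvPolynomial.X i),
      sphereInt_C_mul, sphereInt_X hD]
    simp
  | succ m =>
    -- The cut-off makes whole-space integration by parts legitimate; its radial moment is positive
    -- and cancels at the end.
    obtain ⟨b, hb, hbc, hb0, hb1⟩ : ∃ b : ℝ → ℝ, ContDiff ℝ 1 b ∧ HasCompactSupport b ∧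
        (∀ r, 0 ≤ b r) ∧ ∀ r, |r| ≤ 1 → b r = 1 := by
      let b : ContDiffBump (0 : ℝ) := ⟨1, 2, one_pos, one_lt_two⟩
      exact ⟨b, b.contDiff, b.hasCompactSupport, fun r => b.nonneg, fun r hr =>
        b.one_of_mem_closedBall (by simpa using hr)⟩
    have hbd : Continuous (deriv b) := hb.continuous_deriv le_rfl
    have hfd : ∀ x : E D, HasFDerivAt (fun x : E D => b (‖x‖ ^ 2))
        (deriv b (‖x‖ ^ 2) • (2 • innerSL ℝ x)) x := fun x =>
      HasDerivAt.comp_hasFDerivAt (h₂ := b) (f := fun x : E D => ‖x‖ ^ 2) x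
        (((hb.differentiable one_ne_zero) (‖x‖ ^ 2)).hasDerivAt)
        (hasStrictFDerivAt_norm_sq x).hasFDerivAt
    have hfd' : ∀ x : E D, fderiv ℝ (fun x : E D => b (‖x‖ ^ 2)) x (EuclideanSpace.single i 1)
        = 2 * deriv b (‖x‖ ^ 2) * x i := by
      intro x
      rw [(hfd x).fderiv]
      simp [EuclideanSpace.inner_single_right]
      ring
    have hparts := integral_mul_fderiv_eq_neg_fderiv_mul_of_integrable (μ := (volume : Measure (E D)))
      (f := polyFun q) (g := fun x : E D => b (‖x‖ ^ 2)) (v := EuclideanSpace.single i 1)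
      (by
        simp only [fderiv_polyFun_single]
        exact Continuous.integrable_of_hasCompactSupport
          (by have := hb.continuous; have := continuous_polyFun (MvPolynomial.pderiv i q); fun_prop)
          (hbc.comp_norm_sq).mul_left)
      (by
        simp only [hfd']
        exact Continuous.integrable_of_hasCompactSupport
          (by have := continuous_polyFun q; fun_prop)
          (HasCompactSupport.mul_left (HasCompactSupport.mul_right
            (HasCompactSupport.mul_left (hbc.deriv.comp_norm_sq)))))
      (Continuous.integrable_of_hasCompactSupport
          (by have := hb.continuous; have := continuous_polyFun q; fun_prop)
          (hbc.comp_norm_sq).mul_left)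
      (fun x _ => (hasFDerivAt_polyFun q x).differentiableAt)
      (fun x _ => (hfd x).differentiableAt)
    simp only [fderiv_polyFun_single, hfd'] at hparts
    have e1 := integral_radial_mul_polyFun hD (fun r => 2 * deriv b (r ^ 2))
      ((MvPolynomial.isHomogeneous_X ℝ i).mul hq)
    have e2 := integral_radial_mul_polyFun hD (fun r => b (r ^ 2)) (pderiv_isHomogeneous_succ hq i)
    have e3 := integral_pow_succ_mul_deriv hb hbc (D - 1 + m)
    -- The moment of b' becomes the moment of b times -(D + m); this is where the constant deg q + D
    -- - 1 comes from.
    rw [show D - 1 + (1 + (m + 1)) = D - 1 + m + 2 by ring, e3] at e1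
    have e4 : ∫ x : E D, polyFun q x * (2 * deriv b (‖x‖ ^ 2) * x i)
        = ∫ x : E D, 2 * deriv b (‖x‖ ^ 2) * polyFun (MvPolynomial.X i * q) x := by
      congr 1 with x; rw [polyFun_mul, polyFun_X]; ring
    have e5 : ∫ x : E D, polyFun (MvPolynomial.pderiv i q) x * b (‖x‖ ^ 2)
        = ∫ x : E D, b (‖x‖ ^ 2) * polyFun (MvPolynomial.pderiv i q) x := by
      congr 1 with x; ring
    rw [e4, e5, e1, e2] at hparts
    have hpos : 0 < ∫ r in Set.Ioi (0 : ℝ), r ^ (D - 1 + m) * b (r ^ 2) :=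
      integral_pow_mul_pos hb.continuous hbc hb0 hb1 _
    have hc : ((D - 1 + m : ℕ) : ℝ) + 1 = ((m + 1 : ℕ) : ℝ) + D - 1 := by
      push_cast [Nat.cast_sub hD]; ring
    rw [hc] at hparts
    refine mul_left_cancel₀ hpos.ne' ?_
    linarith

/-! ### Harmonic polynomials on the sphere -/

lemma sphereInt_linForm_mul (hD : 1 ≤ D) (η : Fin D → ℝ) {m : ℕ} {q : MvPolynomial (Fin D) ℝ}
    (hq : q.IsHomogeneous m) :
    ((m : ℝ) + D - 1) * sphereInt D (linForm η * q) = sphereInt D (dirDeriv η q) := by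
  simp only [linForm, dirDeriv_apply, Finset.sum_mul, map_sum, Finset.mul_sum, mul_assoc,
    sphereInt_C_mul]
  refine Finset.sum_congr rfl fun i _ => ?_
  rw [← sphereInt_X_mul hD hq i]
  ring

/-- Euler's identity produces factors X_k, to which integration by parts on the sphere can be
applied. -/
lemma natCast_mul_sphereInt {m : ℕ} {q : MvPolynomial (Fin D) ℝ} (hq : q.IsHomogeneous m)
    (p : MvPolynomial (Fin D) ℝ) :
    (m : ℝ) * sphereInt D (p * q) =
      ∑ k, sphereInt D (MvPolynomial.X k * (p * MvPolynomial.pderiv k q)) := by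
  have h := hq.sum_X_mul_pderiv
  rw [← smul_eq_mul, ← map_smul, ← map_sum]
  congr 1
  rw [← Nat.cast_smul_eq_nsmul ℝ] at h
  rw [← mul_smul_comm, ← h, Finset.mul_sum]
  exact Finset.sum_congr rfl fun k _ => by ring

lemma sphereInt_of_harmonic (hD : 1 ≤ D) {m : ℕ} {Y : MvPolynomial (Fin D) ℝ}
    (hY : Y.IsHomogeneous (m + 1)) (hΔ : polyLaplacian D Y = 0) : sphereInt D Y = 0 := by
  have h := natCast_mul_sphereInt hY 1
  simp only [one_mul] at h
  have hs : ∑ k, sphereInt D (MvPolynomial.X k * MvPolynomial.pderiv k Y) = 0 := by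
    cases m with
    | zero =>
      refine Finset.sum_eq_zero fun k _ => ?_
      rw [MvPolynomial.totalDegree_eq_zero_iff_eq_C.1
        ((MvPolynomial.totalDegree_zero_iff_isHomogeneous _).2 (pderiv_isHomogeneous_succ hY k)),
        mul_comm, sphereInt_C_mul, sphereInt_X hD, mul_zero]
    | succ m =>
      have hne : (((m + 1 : ℕ) : ℝ) + D - 1) ≠ 0 := by
        have : (1 : ℝ) ≤ D := by exact_mod_cast hD
        push_cast
        have := (Nat.cast_nonneg (α := ℝ) m); intro h0; linarith
      refine mul_left_cancel₀ hne ?_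
      rw [mul_zero, Finset.mul_sum]
      simp only [sphereInt_X_mul hD (pderiv_isHomogeneous_succ hY _)]
      rw [← map_sum, ← polyLaplacian_apply, hΔ, map_zero]
  rw [hs] at h
  have : ((m + 1 : ℕ) : ℝ) ≠ 0 := by positivity
  exact (mul_eq_zero.1 h).resolve_left this

/-- Harmonic polynomials are orthogonal to all polynomials of lower degree on the sphere. -/
lemma sphereInt_harmonic_mul (hD : 1 ≤ D) {i m : ℕ} (him : i < m) {Y q : MvPolynomial (Fin D) ℝ}
    (hY : Y.IsHomogeneous m) (hΔ : polyLaplacian D Y = 0) (hq : q.IsHomogeneous i) :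
    sphereInt D (Y * q) = 0 := by
  induction i using Nat.strong_induction_on generalizing m Y q with
  | _ i ih =>
  obtain ⟨m, rfl⟩ : ∃ k, m = k + 1 := ⟨m - 1, by omega⟩
  cases i with
  | zero =>
    rw [MvPolynomial.totalDegree_eq_zero_iff_eq_C.1
      ((MvPolynomial.totalDegree_zero_iff_isHomogeneous _).2 hq), mul_comm, sphereInt_C_mul,
      sphereInt_of_harmonic hD hY hΔ, mul_zero]
  | succ i =>
    -- Euler's identity for q and integration by parts leave the pairs (∂_k Y, ∂_k q) and (Y, ∂_k²
    -- q). In both, the first factor is harmonic and of higher degree than the second, whose degree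
    -- has dropped below that of q.
    have h := natCast_mul_sphereInt hq Y
    rw [Finset.sum_eq_zero fun k _ => ?_] at h
    · have : ((i + 1 : ℕ) : ℝ) ≠ 0 := by positivity
      exact (mul_eq_zero.1 h).resolve_left this
    have hp := pderiv_isHomogeneous_succ hq k
    have h2 := sphereInt_X_mul hD (hY.mul hp) k
    rw [MvPolynomial.pderiv_mul, map_add, ih i (by omega) (by omega)
      (pderiv_isHomogeneous_succ hY k) (by rw [polyLaplacian_pderiv, hΔ, map_zero]) hp] at h2
    have h3 : sphereInt D (Y * MvPolynomial.pderiv k (MvPolynomial.pderiv k q)) = 0 := by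
      cases i with
      | zero => rw [pderiv_of_isHomogeneous_zero hp, mul_zero, map_zero]
      | succ i => exact ih i (by omega) (by omega) hY hΔ (pderiv_isHomogeneous_succ hp k)
    rw [h3, add_zero] at h2
    have hne : (((m + 1 + i : ℕ) : ℝ) + D - 1) ≠ 0 := by
      have : (1 : ℝ) ≤ D := by exact_mod_cast hD
      push_cast
      have := (Nat.cast_nonneg (α := ℝ) m); intro h0; linarith
    exact (mul_eq_zero.1 h2).resolve_left hne

/-- The G_{m-1} term of the recurrence drops out, because Y is orthogonal to polynomials of lower
degree. -/
lemma succ_mul_sphereInt_homGegenbauer_succ (hD : 1 ≤ D) (ν : ℝ) (η : Fin D → ℝ) {m : ℕ}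
    {Y : MvPolynomial (Fin D) ℝ} (hY : Y.IsHomogeneous (m + 1)) (hΔ : polyLaplacian D Y = 0) :
    ((m : ℝ) + 1) * sphereInt D (homGegenbauer ν η (m + 1) * Y) =
      2 * (m + ν) * sphereInt D (linForm η * (homGegenbauer ν η m * Y)) := by
  cases m with
  | zero =>
    simp only [homGegenbauer, mul_assoc, sphereInt_C_mul]
    simp
  | succ m =>
    have h0 : sphereInt D (homGegenbauer ν η m * Y) = 0 := by
      rw [mul_comm]
      exact sphereInt_harmonic_mul hD (by omega) hY hΔ (homGegenbauer_isHomogeneous ν η m)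
    have e : homGegenbauer ν η (m + 1 + 1) * Y = MvPolynomial.C (((m : ℝ) + 2)⁻¹) *
        (MvPolynomial.C (2 * ((m : ℝ) + 1 + ν)) *
            (linForm η * (homGegenbauer ν η (m + 1) * Y))
          - MvPolynomial.C ((m : ℝ) + 2 * ν) * (quadForm D * (homGegenbauer ν η m * Y))) := by
      rw [homGegenbauer]; ring
    rw [e, sphereInt_C_mul, map_sub, sphereInt_C_mul, sphereInt_C_mul, sphereInt_quadForm_mul, h0]
    have : (m : ℝ) + 2 ≠ 0 := by positivity
    push_cast
    field_simp
    ring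

lemma eval_dirDeriv_self {m : ℕ} {q : MvPolynomial (Fin D) ℝ} (hq : q.IsHomogeneous m)
    (η : Fin D → ℝ) :
    MvPolynomial.eval η (dirDeriv η q) = m * MvPolynomial.eval η q := by
  have h := congrArg (MvPolynomial.eval η) hq.sum_X_mul_pderiv
  rw [dirDeriv_apply]
  simpa using h

/-- A Funk–Hecke formula in top degree. Each step trades G_{m+1} for η·x times G_m, and integration
by parts turns η·x into a derivative along η. The derivative falling on G_m contributes nothing; the
one falling on Y gives (m+1) Y(η) at η by Euler. The factor (m+ν)/(m+D/2) is 2(m+ν)/(m+1) times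
(m+1)/(2m+D). -/
lemma sphereInt_homGegenbauer_mul (hD : 1 ≤ D) (ν : ℝ) (η : Fin D → ℝ)
    {m : ℕ} {Y : MvPolynomial (Fin D) ℝ} (hY : Y.IsHomogeneous m) (hΔ : polyLaplacian D Y = 0) :
    sphereInt D (homGegenbauer ν η m * Y) =
      (∏ i ∈ Finset.range m, ((i : ℝ) + ν) / (i + D / 2)) * sphereInt D 1
        * MvPolynomial.eval η Y := by
  induction m generalizing Y with
  | zero =>
    rw [MvPolynomial.totalDegree_eq_zero_iff_eq_C.1
      ((MvPolynomial.totalDegree_zero_iff_isHomogeneous _).2 hY), mul_comm, sphereInt_C_mul]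
    simp [homGegenbauer, mul_comm]
  | succ m ih =>
    have hd := dirDeriv_isHomogeneous_succ hY η
    have h1 := succ_mul_sphereInt_homGegenbauer_succ hD ν η hY hΔ
    have h2 := sphereInt_linForm_mul hD η ((homGegenbauer_isHomogeneous ν η m).mul hY)
    rw [Derivation.leibniz, smul_eq_mul, smul_eq_mul, map_add,
      ih hd (by rw [polyLaplacian_dirDeriv, hΔ, map_zero]), eval_dirDeriv_self hY] at h2
    have h3 : sphereInt D (Y * dirDeriv η (homGegenbauer ν η m)) = 0 := by
      cases m with
      | zero => simp [homGegenbauer]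
      | succ m =>
        exact sphereInt_harmonic_mul hD (by omega) hY hΔ
          (dirDeriv_isHomogeneous_succ (homGegenbauer_isHomogeneous ν η _) η)
    rw [h3, add_zero] at h2
    rw [Finset.prod_range_succ]
    have hD' : (1 : ℝ) ≤ D := by exact_mod_cast hD
    have hne : (m : ℝ) + D / 2 ≠ 0 := by positivity
    have hm : (m : ℝ) + 1 ≠ 0 := by positivity
    refine mul_left_cancel₀ hm (mul_left_cancel₀ hne ?_)
    rw [h1]
    push_cast at h2
    have e : ((m : ℝ) + D / 2) * (2 * (m + ν)
          * sphereInt D (linForm η * (homGegenbauer ν η m * Y)))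
        = (m + ν) * (((m : ℝ) + (m + 1) + D - 1)
          * sphereInt D (linForm η * (homGegenbauer ν η m * Y))) := by ring
    rw [e, h2]
    generalize (∏ i ∈ Finset.range m, ((i : ℝ) + ν) / (i + D / 2)) = p
    field_simp

lemma exists_smul_sphere (hD : 1 ≤ D) (x : E D) : ∃ (r : ℝ) (e : S D), x = r • (e : E D) := by
  by_cases hx : x = 0
  · refine ⟨0, ⟨EuclideanSpace.single ⟨0, hD⟩ 1, by simp⟩, by simp [hx]⟩
  · have hx' : ‖x‖ ≠ 0 := norm_ne_zero_iff.2 hx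
    refine ⟨‖x‖, ⟨‖x‖⁻¹ • x, by simp [norm_smul, hx']⟩, ?_⟩
    rw [smul_smul, mul_inv_cancel₀ hx', one_smul]

lemma continuous_polyFun_sphere (q : MvPolynomial (Fin D) ℝ) :
    Continuous fun ξ : S D => polyFun q (ξ : E D) :=
  (continuous_polyFun q).comp continuous_subtype_val

lemma eq_zero_of_sphereInt_mul_self (hD : 1 ≤ D) {m : ℕ} {q : MvPolynomial (Fin D) ℝ}
    (hq : q.IsHomogeneous m) (h : sphereInt D (q * q) = 0) : q = 0 := by
  rw [sphereInt_apply] at h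
  simp only [polyFun_mul] at h
  have hc := continuous_polyFun_sphere q
  rw [integral_eq_zero_iff_of_nonneg (fun ξ => mul_self_nonneg _)
    ((hc.mul hc).integrable_of_hasCompactSupport (HasCompactSupport.of_compactSpace _))] at h
  have : (surfaceMeasure D).IsOpenPosMeasure := by unfold surfaceMeasure; infer_instance
  have h' := (Continuous.ae_eq_iff_eq (surfaceMeasure D) (hc.mul hc) continuous_zero).1 h
  refine MvPolynomial.funext fun x => ?_
  obtain ⟨r, e, hre⟩ := exists_smul_sphere hD (WithLp.toLp 2 x)
  have h1 : polyFun q (e : E D) = 0 := mul_self_eq_zero.1 (congrFun h' e)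
  have h2 : polyFun q (WithLp.toLp 2 x) = 0 := by
    rw [hre, polyFun_smul_of_isHomogeneous hq, h1, mul_zero]
  simpa [polyFun] using h2

/-- Every homogeneous polynomial is harmonic up to a multiple of `|x|²`. -/
lemma exists_harmonic_add_quadForm_mul (hD : 1 ≤ D) {m : ℕ} {q : MvPolynomial (Fin D) ℝ}
    (hq : q.IsHomogeneous (m + 2)) :
    ∃ Y r : MvPolynomial (Fin D) ℝ, Y.IsHomogeneous (m + 2) ∧ polyLaplacian D Y = 0 ∧
      r.IsHomogeneous m ∧ q = Y + quadForm D * r := by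
  have hmul : ∀ r : MvPolynomial (Fin D) ℝ, r.IsHomogeneous m →
      (quadForm D * r).IsHomogeneous (m + 2) := fun r hr => by
    simpa [add_comm] using quadForm_isHomogeneous.mul hr
  have hfin : FiniteDimensional ℝ (MvPolynomial.homogeneousSubmodule (Fin D) ℝ m) :=
    Module.Finite.iff_fg.2 (MvPolynomial.homogeneousSubmodule_fg _ _ _)
  let T := (polyLaplacian D ∘ₗ LinearMap.mulLeft ℝ (quadForm D)).restrict
    (p := MvPolynomial.homogeneousSubmodule (Fin D) ℝ m)
    (q := MvPolynomial.homogeneousSubmodule (Fin D) ℝ m)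
    fun r hr => polyLaplacian_isHomogeneous (hmul r hr)
  -- If |x|² r is harmonic, it is orthogonal to r, so r² integrates to zero on the sphere and r = 0.
  -- An injective endomorphism of a finite-dimensional space is surjective, which solves Δ(|x|² r) =
  -- Δq.
  have hT : Function.Injective T := by
    rw [injective_iff_map_eq_zero]
    rintro ⟨r, hr⟩ h
    have h0 : polyLaplacian D (quadForm D * r) = 0 := congrArg Subtype.val h
    have h1 := sphereInt_harmonic_mul hD (by omega) (hmul r hr) h0 hr
    rw [mul_assoc, sphereInt_quadForm_mul] at h1
    exact Subtype.ext (eq_zero_of_sphereInt_mul_self hD hr h1)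
  obtain ⟨⟨r, hr⟩, h⟩ := (LinearMap.injective_iff_surjective.1 hT)
    ⟨polyLaplacian D q, polyLaplacian_isHomogeneous hq⟩
  have h0 : polyLaplacian D (quadForm D * r) = polyLaplacian D q := congrArg Subtype.val h
  exact ⟨q - quadForm D * r, r, hq.sub (hmul r hr), by rw [map_sub, h0, sub_self], hr, by ring⟩

lemma eval_quadForm {η : Fin D → ℝ} (hη : ∑ i, η i ^ 2 = 1) :
    MvPolynomial.eval η (quadForm D) = 1 := by
  simp [quadForm, hη]

/-- For `ν = D/2`, the Gegenbauer kernel reproduces homogeneous polynomials on the sphere. -/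
lemma sphereInt_homGegenbauer_mul_eq_eval (hD : 1 ≤ D) {ν : ℝ} (hν : (D : ℝ) = 2 * ν)
    {η : Fin D → ℝ} (hη : ∑ i, η i ^ 2 = 1) {m : ℕ} {q : MvPolynomial (Fin D) ℝ}
    (hq : q.IsHomogeneous m) :
    sphereInt D (homGegenbauer ν η m * q) = sphereInt D 1 * MvPolynomial.eval η q := by
  -- For ν = D/2 every factor of the Funk–Hecke product equals 1, which settles harmonic q.
  have key : ∀ {m : ℕ} {q : MvPolynomial (Fin D) ℝ}, q.IsHomogeneous m → polyLaplacian D q = 0 →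
      sphereInt D (homGegenbauer ν η m * q) = sphereInt D 1 * MvPolynomial.eval η q := by
    intro m q hq hΔ
    rw [sphereInt_homGegenbauer_mul hD ν η hq hΔ, Finset.prod_eq_one, one_mul]
    intro i _
    have hD' : (1 : ℝ) ≤ D := by exact_mod_cast hD
    rw [hν, mul_div_cancel_left₀ _ two_ne_zero, div_self]
    have : 0 < ν := by linarith
    positivity
  induction m using Nat.twoStepInduction generalizing q with
  | zero => exact key hq (polyLaplacian_of_isHomogeneous_le_one zero_le_one hq)
  | one => exact key hq (polyLaplacian_of_isHomogeneous_le_one le_rfl hq)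
  | more m h0 h1 =>
    obtain ⟨Y, r, hY, hΔ, hr, rfl⟩ := exists_harmonic_add_quadForm_mul hD hq
    have hW : (homGegenbauer ν η (m + 2) - quadForm D * homGegenbauer ν η m).IsHomogeneous
        (m + 2) := by
      refine (homGegenbauer_isHomogeneous ν η _).sub ?_
      simpa [add_comm] using quadForm_isHomogeneous.mul (homGegenbauer_isHomogeneous ν η m)
    -- The harmonic difference of degree m + 2 does not see r, so G_{m+2} may be replaced by G_m
    -- against r, and the induction hypothesis applies.
    have h2 := sphereInt_harmonic_mul hD (by omega) hW (polyLaplacian_homGegenbauer_sub hν hη m) hr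
    rw [sub_mul, map_sub, mul_assoc, sphereInt_quadForm_mul, h0 hr] at h2
    rw [mul_add, map_add, key hY hΔ, mul_left_comm, sphereInt_quadForm_mul, map_add,
      map_mul (MvPolynomial.eval η),
      eval_quadForm hη]
    linarith

/-- For `D = 2ν + 2`, the Gegenbauer kernels are orthogonal on the sphere. -/
lemma sphereInt_homGegenbauer_mul_homGegenbauer {ν : ℝ} (hν : 0 < ν) (hDν : (D : ℝ) = 2 * ν + 2)
    {ξ η : Fin D → ℝ} (hξ : ∑ i, ξ i ^ 2 = 1) (hη : ∑ i, η i ^ 2 = 1) (k m : ℕ) :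
    sphereInt D (homGegenbauer ν ξ k * homGegenbauer ν η m) =
      if k = m then ν / (m + ν) * sphereInt D 1 * MvPolynomial.eval ξ (homGegenbauer ν η m)
      else 0 := by
  have hD : 1 ≤ D := by
    have : (1 : ℝ) ≤ D := by linarith
    exact_mod_cast this
  split_ifs with h
  · subst h
    rw [sphereInt_homGegenbauer_mul hD ν ξ (homGegenbauer_isHomogeneous ν η k)
      (polyLaplacian_homGegenbauer_of_add_two hDν hη k)]
    congr 2
    -- For D = 2ν + 2 the factors are (i+ν)/(i+1+ν), and the product telescopes to ν/(k+ν).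
    induction k with
    | zero => simp [hν.ne']
    | succ k ih =>
      rw [Finset.prod_range_succ, ih, hDν]
      have : (k : ℝ) + ν ≠ 0 := by positivity
      have : (k : ℝ) + 1 + ν ≠ 0 := by positivity
      have : (k : ℝ) + (2 * ν + 2) / 2 ≠ 0 := by positivity
      push_cast
      field_simp
      ring
  · rcases lt_or_gt_of_ne h with h | h
    · rw [mul_comm]
      exact sphereInt_harmonic_mul hD h (homGegenbauer_isHomogeneous ν η m)
        (polyLaplacian_homGegenbauer_of_add_two hDν hη m) (homGegenbauer_isHomogeneous ν ξ k)
    · exact sphereInt_harmonic_mul hD h (homGegenbauer_isHomogeneous ν ξ k)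
        (polyLaplacian_homGegenbauer_of_add_two hDν hξ k) (homGegenbauer_isHomogeneous ν η m)

/-! ### Evaluation of ridge polynomials -/

lemma polyFun_aeval (ℓ : MvPolynomial (Fin D) ℝ) (f : ℝ[X]) (x : E D) :
    polyFun (aeval ℓ f) x = f.eval (polyFun ℓ x) := by
  rw [polyFun, polyFun, Polynomial.aeval_def, Polynomial.hom_eval₂, Polynomial.eval]
  congr 1
  ext r
  exact MvPolynomial.eval_C r

lemma polyFun_linForm_ofLp (ξ x : E D) : polyFun (linForm ξ.ofLp) x = inner ℝ ξ x := by
  simp [polyFun_linForm, PiLp.inner_apply, mul_comm]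

lemma polyFun_ridge (ξ : E D) (f : ℝ[X]) (x : E D) :
    polyFun (aeval (linForm ξ.ofLp) f) x = f.eval (inner ℝ ξ x) := by
  rw [polyFun_aeval, polyFun_linForm_ofLp]

lemma sum_sq_sphere (ξ : S D) : ∑ i, (ξ : E D) i ^ 2 = 1 := by
  have h := polyFun_quadForm_sphere ξ
  simpa [quadForm, polyFun] using h

lemma eval_homGegenbauer (ν : ℝ) (η : Fin D → ℝ) {x : Fin D → ℝ} (hx : ∑ i, x i ^ 2 = 1) (m : ℕ) :
    MvPolynomial.eval x (homGegenbauer ν η m) =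
      (gegenbauer ν m).eval (MvPolynomial.eval x (linForm η)) := by
  induction m using Nat.twoStepInduction with
  | zero => simp [homGegenbauer, gegenbauer]
  | one => simp [homGegenbauer, gegenbauer]
  | more m h0 h1 => simp [homGegenbauer, gegenbauer, h0, h1, eval_quadForm hx]

lemma polyFun_homGegenbauer_sphere (ν : ℝ) (η : Fin D → ℝ) (x : S D) (m : ℕ) :
    polyFun (homGegenbauer ν η m) (x : E D) =
      polyFun (aeval (linForm η) (gegenbauer ν m)) (x : E D) := by
  rw [polyFun_aeval]
  exact eval_homGegenbauer ν η (sum_sq_sphere x) m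

/-! ### The ball as a projection of a sphere -/

/-- The integral of polynomials over the unit ball. -/
def ballInt (d : ℕ) : MvPolynomial (Fin d) ℝ →ₗ[ℝ] ℝ where
  toFun q := ∫ x in unitBall d, polyFun q x
  map_add' p q := by
    simp only [polyFun_add]
    exact integral_add
      ((continuous_polyFun p).continuousOn.integrableOn_compact (isCompact_closedBall _ _))
      ((continuous_polyFun q).continuousOn.integrableOn_compact (isCompact_closedBall _ _))
  map_smul' c q := by simp [integral_const_mul]

lemma ballInt_apply (q : MvPolynomial (Fin d) ℝ) : ballInt d q = ∫ x in unitBall d, polyFun q x :=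
  rfl

lemma ballInt_C_mul (c : ℝ) (q : MvPolynomial (Fin d) ℝ) :
    ballInt d (MvPolynomial.C c * q) = c * ballInt d q := by
  rw [← MvPolynomial.smul_eq_C_mul, map_smul, smul_eq_mul]

/-- The constant m + d + 1 is the one that integration by parts gives on the sphere in d + 2
variables; this coincidence identifies the two integrals. -/
lemma ballInt_X_mul (hd : 1 ≤ d) {m : ℕ} {q : MvPolynomial (Fin d) ℝ} (hq : q.IsHomogeneous m)
    (i : Fin d) :
    ((m : ℝ) + d + 1) * ballInt d (MvPolynomial.X i * q) =
      ballInt d (MvPolynomial.pderiv i q) := by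
  have hd' : (1 : ℝ) ≤ d := by exact_mod_cast hd
  have h := sphereInt_X_mul hd hq i
  rw [ballInt_apply, integral_unitBall_polyFun hd ((MvPolynomial.isHomogeneous_X ℝ i).mul hq)]
  cases m with
  | zero =>
    rw [pderiv_of_isHomogeneous_zero hq, map_zero, MvPolynomial.totalDegree_eq_zero_iff_eq_C.1
      ((MvPolynomial.totalDegree_zero_iff_isHomogeneous _).2 hq), mul_comm (MvPolynomial.X i),
      sphereInt_C_mul, sphereInt_X hd]
    simp
  | succ m =>
    rw [ballInt_apply, integral_unitBall_polyFun hd (pderiv_isHomogeneous_succ hq i), ← h]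
    push_cast
    have h1 : (1 : ℝ) + (m + 1) + d ≠ 0 := by positivity
    have h2 : (m : ℝ) + d ≠ 0 := by positivity
    field_simp
    ring

lemma ballInt_linForm_mul (hd : 1 ≤ d) (η : Fin d → ℝ) {m : ℕ} {q : MvPolynomial (Fin d) ℝ}
    (hq : q.IsHomogeneous m) :
    ((m : ℝ) + d + 1) * ballInt d (linForm η * q) = ballInt d (dirDeriv η q) := by
  simp only [linForm, dirDeriv_apply, Finset.sum_mul, map_sum, Finset.mul_sum, mul_assoc,
    ballInt_C_mul]
  refine Finset.sum_congr rfl fun i _ => ?_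
  rw [← ballInt_X_mul hd hq i]
  ring

lemma linearMap_eq_zero_of_homogeneous (φ : MvPolynomial (Fin d) ℝ →ₗ[ℝ] ℝ)
    {q : MvPolynomial (Fin d) ℝ} {N : ℕ} (hN : q.totalDegree ≤ N)
    (h : ∀ m ≤ N, ∀ p : MvPolynomial (Fin d) ℝ, p.IsHomogeneous m → φ p = 0) : φ q = 0 := by
  rw [← MvPolynomial.sum_homogeneousComponent q, map_sum]
  refine Finset.sum_eq_zero fun i hi => h i ?_ _ (MvPolynomial.homogeneousComponent_isHomogeneous _ _)
  have := Finset.mem_range.1 hi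
  omega

/-- By Euler's identity a functional satisfying such a recursion is determined by its value at 1. It
is applied to the difference of two normalised integrals. -/
lemma linearMap_eq_zero_of_rec (φ : MvPolynomial (Fin d) ℝ →ₗ[ℝ] ℝ) (h1 : φ 1 = 0)
    (h : ∀ (m : ℕ) (q : MvPolynomial (Fin d) ℝ), q.IsHomogeneous m → ∀ i,
      φ (MvPolynomial.pderiv i q) = 0 → φ (MvPolynomial.X i * q) = 0) : φ = 0 := by
  refine LinearMap.ext fun q => linearMap_eq_zero_of_homogeneous φ le_rfl fun m _ p hp => ?_
  clear * - h1 h hp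
  induction m using Nat.strong_induction_on generalizing p with
  | _ m ih =>
  cases m with
  | zero =>
    rw [MvPolynomial.totalDegree_eq_zero_iff_eq_C.1
      ((MvPolynomial.totalDegree_zero_iff_isHomogeneous _).2 hp), ← mul_one (MvPolynomial.C _),
      ← MvPolynomial.smul_eq_C_mul, map_smul, h1, smul_zero]
  | succ m =>
    have he := congrArg φ hp.sum_X_mul_pderiv
    rw [← Nat.cast_smul_eq_nsmul ℝ, map_smul, map_sum, Finset.sum_eq_zero fun k _ => ?_] at he
    · exact (smul_eq_zero.1 he.symm).resolve_left (by positivity)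
    have hk := pderiv_isHomogeneous_succ hp k
    refine h m _ hk k ?_
    cases m with
    | zero => rw [pderiv_of_isHomogeneous_zero hk, map_zero]
    | succ m => exact ih m (by omega) _ (pderiv_isHomogeneous_succ hk k)

/-- Polynomials in the first `d` of `d + 2` variables. -/
def lift (d : ℕ) : MvPolynomial (Fin d) ℝ →ₐ[ℝ] MvPolynomial (Fin (d + 2)) ℝ :=
  MvPolynomial.rename (Fin.castAdd 2)

/-- Archimedes' projection principle: both sides obey the same recursion under multiplication by a
variable and agree at q = 1. -/
lemma ballInt_mul_sphereInt_one (hd : 1 ≤ d) (q : MvPolynomial (Fin d) ℝ) :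
    sphereInt (d + 2) 1 * ballInt d q = ballInt d 1 * sphereInt (d + 2) (lift d q) := by
  let φ : MvPolynomial (Fin d) ℝ →ₗ[ℝ] ℝ := sphereInt (d + 2) 1 • ballInt d
    - ballInt d 1 • (sphereInt (d + 2) ∘ₗ (lift d).toLinearMap)
  have hφ : φ = 0 := by
    refine linearMap_eq_zero_of_rec φ ?_ fun m q hq i h => ?_
    · simp [φ, mul_comm]
    · have e1 := ballInt_X_mul hd hq i
      have e2 := sphereInt_X_mul (by omega : 1 ≤ d + 2)
        (q := lift d q) (MvPolynomial.IsHomogeneous.rename_isHomogeneous hq) (Fin.castAdd 2 i)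
      have e3 : MvPolynomial.pderiv (Fin.castAdd 2 i) (lift d q)
          = lift d (MvPolynomial.pderiv i q) :=
        MvPolynomial.pderiv_rename (Fin.castAdd_injective d 2) i q
      have e4 : lift d (MvPolynomial.X i * q) = MvPolynomial.X (Fin.castAdd 2 i) * lift d q := by
        simp [lift]
      rw [e3, ← e4] at e2
      have hne : (m : ℝ) + d + 1 ≠ 0 := by positivity
      refine mul_left_cancel₀ hne ?_
      simp only [φ, LinearMap.sub_apply, LinearMap.smul_apply, LinearMap.comp_apply,
        AlgHom.toLinearMap_apply, smul_eq_mul] at h ⊢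
      rw [← e1, ← e2] at h
      push_cast at h
      linear_combination h
  have := LinearMap.congr_fun hφ q
  simp only [φ, LinearMap.sub_apply, LinearMap.smul_apply, LinearMap.comp_apply,
    AlgHom.toLinearMap_apply, smul_eq_mul, LinearMap.zero_apply] at this
  linarith

lemma ballInt_one : ballInt d 1 = (volume : Measure (E d)).real (Metric.ball 0 1) := by
  rw [measureReal_def, ← Measure.addHaar_unitClosedBall_eq_addHaar_unitBall]
  simp [ballInt_apply, unitBall, measureReal_def]

lemma sphereInt_one : sphereInt d 1 = d * ballInt d 1 := by
  simp [sphereInt_apply, ballInt_one, surfaceMeasure]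

lemma ballInt_one_pos : 0 < ballInt d 1 := by
  rw [ballInt_one, measureReal_def]
  exact ENNReal.toReal_pos (Metric.measure_ball_pos _ _ one_pos).ne' measure_ball_lt_top.ne

lemma sphereInt_one_pos (hd : 1 ≤ d) : 0 < sphereInt d 1 := by
  rw [sphereInt_one]
  exact mul_pos (by exact_mod_cast hd) ballInt_one_pos

lemma lift_ridge (ξ : Fin d → ℝ) (f : ℝ[X]) :
    lift d (aeval (linForm ξ) f) = aeval (linForm (Fin.append ξ (0 : Fin 2 → ℝ))) f := by
  have : lift d (linForm ξ) = linForm (Fin.append ξ (0 : Fin 2 → ℝ)) := by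
    simp [linForm, lift, Fin.sum_univ_add]
  rw [← this, Polynomial.aeval_algHom_apply]

lemma sum_sq_append {ξ : Fin d → ℝ} (hξ : ∑ i, ξ i ^ 2 = 1) :
    ∑ i, (Fin.append ξ (0 : Fin 2 → ℝ)) i ^ 2 = 1 := by
  simp [Fin.sum_univ_add, hξ]

lemma sphereInt_congr {p q : MvPolynomial (Fin D) ℝ}
    (h : ∀ x : S D, polyFun p (x : E D) = polyFun q (x : E D)) :
    sphereInt D p = sphereInt D q := by
  simp only [sphereInt_apply, h]

/-- Ridge Gegenbauer polynomials are orthogonal to polynomials of lower degree on the ball. -/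
lemma ballInt_gegenbauer_mul_of_lt (hd : 1 ≤ d) {ξ : Fin d → ℝ} (hξ : ∑ i, ξ i ^ 2 = 1) {k : ℕ}
    {P : MvPolynomial (Fin d) ℝ} (hP : P.totalDegree < k) :
    ballInt d (aeval (linForm ξ) (gegenbauer ((d : ℝ) / 2) k) * P) = 0 := by
  refine linearMap_eq_zero_of_homogeneous
    (ballInt d ∘ₗ LinearMap.mulLeft ℝ (aeval (linForm ξ) (gegenbauer ((d : ℝ) / 2) k))) le_rfl
    fun m hm p hp => ?_
  simp only [LinearMap.comp_apply, LinearMap.mulLeft_apply]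
  refine (mul_eq_zero.1 ?_).resolve_left (sphereInt_one_pos (by omega : 1 ≤ d + 2)).ne'
  rw [ballInt_mul_sphereInt_one hd, map_mul, lift_ridge]
  refine mul_eq_zero_of_right _ ?_
  -- On 𝕊^{d+1} the lifted ridge polynomial equals its homogenisation, which is harmonic because d +
  -- 2 = 2(d/2) + 2.
  rw [sphereInt_congr (q := homGegenbauer ((d : ℝ) / 2) (Fin.append ξ 0) k * lift d p)
    fun x => by rw [polyFun_mul, polyFun_mul, polyFun_homGegenbauer_sphere]]
  exact sphereInt_harmonic_mul (by omega) (lt_of_le_of_lt hm hP) (homGegenbauer_isHomogeneous _ _ _)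
    (polyLaplacian_homGegenbauer_of_add_two (by push_cast; ring) (sum_sq_append hξ) k)
    (MvPolynomial.IsHomogeneous.rename_isHomogeneous hp)

lemma ballInt_gegenbauer_mul_gegenbauer (hd : 1 ≤ d) (ξ η : S d) (k m : ℕ) :
    ballInt d (aeval (linForm (ξ : E d).ofLp) (gegenbauer ((d : ℝ) / 2) k) *
        aeval (linForm (η : E d).ofLp) (gegenbauer ((d : ℝ) / 2) m)) =
      if k = m then (d : ℝ) / 2 / (m + d / 2) * ballInt d 1 *
        (gegenbauer ((d : ℝ) / 2) m).eval (inner ℝ (ξ : E d) (η : E d)) else 0 := by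
  have hd' : (0 : ℝ) < d := by exact_mod_cast hd
  refine mul_left_cancel₀ (sphereInt_one_pos (by omega : 1 ≤ d + 2)).ne' ?_
  rw [ballInt_mul_sphereInt_one hd, map_mul, lift_ridge, lift_ridge,
    sphereInt_congr (q := homGegenbauer ((d : ℝ) / 2) (Fin.append (ξ : E d).ofLp 0) k
        * homGegenbauer ((d : ℝ) / 2) (Fin.append (η : E d).ofLp 0) m)
      fun x => by
        rw [polyFun_mul, polyFun_mul, polyFun_homGegenbauer_sphere, polyFun_homGegenbauer_sphere],
    sphereInt_homGegenbauer_mul_homGegenbauer (by positivity) (by push_cast; ring)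
      (sum_sq_append (sum_sq_sphere ξ)) (sum_sq_append (sum_sq_sphere η)),
    eval_homGegenbauer _ _ (sum_sq_append (sum_sq_sphere ξ))]
  have e : MvPolynomial.eval (Fin.append (ξ : E d).ofLp (0 : Fin 2 → ℝ))
      (linForm (Fin.append (η : E d).ofLp 0)) = inner ℝ (ξ : E d) (η : E d) := by
    simp [linForm, Fin.sum_univ_add, PiLp.inner_apply]
  rw [e]
  split_ifs <;> ring

/-! ### Orthogonality of the Gegenbauer polynomials on the interval -/

lemma continuous_w (hd : 1 ≤ d) : Continuous (w d) := by
  have hd' : (1 : ℝ) ≤ d := by exact_mod_cast hd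
  unfold w
  exact Continuous.rpow_const (by fun_prop) fun _ => Or.inr (by linarith)

lemma integrableOn_I {f : ℝ → ℝ} (hf : Continuous f) : IntegrableOn f I :=
  hf.continuousOn.integrableOn_compact isCompact_Icc

/-- The weighted integral of polynomials over the interval. -/
def weightInt (hd : 1 ≤ d) : ℝ[X] →ₗ[ℝ] ℝ where
  toFun f := ∫ t in I, f.eval t * w d t
  map_add' p q := by
    simp only [eval_add, add_mul]
    exact integral_add (integrableOn_I (p.continuous.mul (continuous_w hd)))
      (integrableOn_I (q.continuous.mul (continuous_w hd)))
  map_smul' c q := by simp [mul_assoc, integral_const_mul]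

lemma weightInt_apply (hd : 1 ≤ d) (f : ℝ[X]) : weightInt hd f = ∫ t in I, f.eval t * w d t := rfl

/-- Integrate the derivative of (1-t²)^{(d+1)/2} t^m, which vanishes at both endpoints. For m = 0
the truncated exponent m - 1 is harmless, since its coefficient is zero. -/
lemma weightInt_rec (hd : 1 ≤ d) (m : ℕ) :
    ((m : ℝ) + d + 1) * weightInt hd (X ^ (m + 1)) = m * weightInt hd (X ^ (m - 1)) := by
  have hd' : (1 : ℝ) ≤ d := by exact_mod_cast hd
  have hder : ∀ t ∈ Set.Ioo (-1 : ℝ) 1, HasDerivAt (fun t => w d t * ((1 - t ^ 2) * t ^ m))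
      (((m : ℝ) • X ^ (m - 1) - ((m : ℝ) + d + 1) • X ^ (m + 1) : ℝ[X]).eval t * w d t) t := by
    intro t ht
    have hpos : 0 < 1 - t ^ 2 := by nlinarith [ht.1, ht.2]
    have h1 : HasDerivAt (fun t : ℝ => 1 - t ^ 2) (-(2 * t)) t := by
      simpa using (hasDerivAt_pow 2 t).const_sub 1
    have h2 := (h1.rpow_const (p := ((d : ℝ) - 1) / 2) (Or.inl hpos.ne')).mul
      (h1.mul (hasDerivAt_pow m t))
    refine h2.congr_deriv ?_
    rw [Real.rpow_sub_one hpos.ne']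
    simp only [w, Pi.mul_apply, eval_sub, eval_pow, eval_X, eval_smul, smul_eq_mul]
    field_simp
    cases m with
    | zero => simp; ring
    | succ m => simp only [Nat.add_sub_cancel]; push_cast; ring
  have hcont : Continuous fun t => w d t * ((1 - t ^ 2) * t ^ m) :=
    (continuous_w hd).mul (by fun_prop)
  have hint := ((((m : ℝ) • X ^ (m - 1) - ((m : ℝ) + d + 1) • X ^ (m + 1) : ℝ[X]).continuous).mul
    (continuous_w hd)).intervalIntegrable (μ := volume) (-1) 1
  have h := intervalIntegral.integral_eq_sub_of_hasDerivAt_of_le (by norm_num : (-1 : ℝ) ≤ 1)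
    hcont.continuousOn hder hint
  rw [intervalIntegral.integral_of_le (by norm_num), ← integral_Icc_eq_integral_Ioc] at h
  change weightInt hd _ = _ at h
  rw [map_sub, map_smul, map_smul] at h
  simp at h
  linarith

lemma linearMap_eq_zero_of_moment_rec (φ : ℝ[X] →ₗ[ℝ] ℝ) (h1 : φ 1 = 0)
    (h : ∀ m : ℕ, ((m : ℝ) + d + 1) * φ (X ^ (m + 1)) = m * φ (X ^ (m - 1))) : φ = 0 := by
  have key : ∀ m : ℕ, φ (X ^ m) = 0 := by
    intro m
    induction m using Nat.strong_induction_on with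
    | _ m ih =>
    cases m with
    | zero => simpa using h1
    | succ m =>
      have hm := h m
      rw [ih (m - 1) (by omega), mul_zero] at hm
      exact (mul_eq_zero.1 hm).resolve_left (by positivity)
  refine LinearMap.ext fun f => ?_
  induction f using Polynomial.induction_on' with
  | add p q hp hq => rw [map_add, hp, hq]; simp
  | monomial n a => rw [← Polynomial.smul_X_eq_monomial, map_smul, key]; simp

/-- The weighted integral is the ball integral of ridge functions, up to normalisation. -/
lemma ballInt_one_mul_weightInt (hd : 1 ≤ d) (ξ : S d) (f : ℝ[X]) :
    ballInt d 1 * weightInt hd f =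
      weightInt hd 1 * ballInt d (aeval (linForm (ξ : E d).ofLp) f) := by
  let φ : ℝ[X] →ₗ[ℝ] ℝ := ballInt d 1 • weightInt hd
    - weightInt hd 1 • (ballInt d ∘ₗ (aeval (linForm (ξ : E d).ofLp)).toLinearMap)
  have hφ : φ = 0 := by
    refine linearMap_eq_zero_of_moment_rec (d := d) φ (by simp [φ, mul_comm]) fun m => ?_
    have e1 := weightInt_rec hd m
    have hℓ := linForm_isHomogeneous (ξ : E d).ofLp
    have e2 := ballInt_linForm_mul hd (ξ : E d).ofLp (hℓ.pow m)
    rw [Derivation.leibniz_pow, dirDeriv_linForm (sum_sq_sphere ξ), one_mul, ← pow_succ',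
      smul_eq_mul, mul_one, map_nsmul, nsmul_eq_mul] at e2
    simp only [φ, LinearMap.sub_apply, LinearMap.smul_apply, LinearMap.comp_apply,
      AlgHom.toLinearMap_apply, smul_eq_mul, map_pow, aeval_X]
    linear_combination ballInt d 1 * e1 - weightInt hd 1 * e2
  have := LinearMap.congr_fun hφ f
  simp only [φ, LinearMap.sub_apply, LinearMap.smul_apply, LinearMap.comp_apply,
    AlgHom.toLinearMap_apply, smul_eq_mul, LinearMap.zero_apply] at this
  linarith

/-- A Beta integral, computed by passing from d to d + 2: the weight gains a factor 1 - t², whose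
second moment the recursion supplies. The cases d = 1 and d = 2 start the induction. -/
lemma weightInt_one (hd : 1 ≤ d) :
    weightInt hd 1 = √Real.pi * Real.Gamma ((d : ℝ) / 2 + 1 / 2) / Real.Gamma ((d : ℝ) / 2 + 1) := by
  have hπ : √Real.pi ≠ 0 := (Real.sqrt_pos.2 Real.pi_pos).ne'
  induction d using Nat.twoStepInduction with
  | zero => omega
  | one =>
    rw [weightInt_apply]
    have : Real.Gamma (3 / 2) = √Real.pi / 2 := by
      have := Real.Gamma_add_one (s := 1 / 2) (by norm_num)
      rw [Real.Gamma_one_half_eq] at this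
      rw [show (3 / 2 : ℝ) = 1 / 2 + 1 by norm_num, this]; ring
    norm_num [w, I, this, Real.Gamma_one]
    field_simp
  | more d h0 _ =>
    by_cases hd0 : d = 0
    · subst hd0
      have h2 : weightInt hd 1 = Real.pi / 2 := by
        rw [weightInt_apply, I, integral_Icc_eq_integral_Ioc,
          ← intervalIntegral.integral_of_le (by norm_num), ← integral_sqrt_one_sub_sq]
        congr 1 with t
        norm_num [w, Real.sqrt_eq_rpow]
      have : Real.Gamma (3 / 2) = √Real.pi / 2 := by
        have := Real.Gamma_add_one (s := 1 / 2) (by norm_num)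
        rw [Real.Gamma_one_half_eq] at this
        rw [show (3 / 2 : ℝ) = 1 / 2 + 1 by norm_num, this]; ring
      rw [h2]
      norm_num [this]
      rw [← mul_div_assoc, Real.mul_self_sqrt Real.pi_pos.le]
    · have hd1 : 1 ≤ d := Nat.one_le_iff_ne_zero.2 hd0
      have hd' : (1 : ℝ) ≤ d := by exact_mod_cast hd1
      have hr := weightInt_rec hd1 1
      have hs : weightInt hd 1 = weightInt hd1 (1 - X ^ 2) := by
        rw [weightInt_apply, weightInt_apply]
        refine setIntegral_congr_fun measurableSet_Icc fun t ht => ?_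
        have ht' : 0 ≤ 1 - t ^ 2 := by nlinarith [ht.1, ht.2]
        simp only [w, eval_one, one_mul, eval_sub, eval_pow, eval_X]
        rw [← Real.rpow_one_add' ht' (by linarith)]
        congr 1; push_cast; ring
      have h1 : weightInt hd1 (X ^ 2) = weightInt hd1 1 / (d + 2) := by
        norm_num at hr
        rw [← hr]
        field_simp; ring
      rw [hs, map_sub, h1, h0 hd1]
      have g1 := Real.Gamma_add_one (s := (d : ℝ) / 2 + 1 / 2) (by positivity)
      have g2 := Real.Gamma_add_one (s := (d : ℝ) / 2 + 1) (by positivity)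
      push_cast
      rw [show ((d : ℝ) + 2) / 2 + 1 / 2 = d / 2 + 1 / 2 + 1 by ring,
        show ((d : ℝ) + 2) / 2 + 1 = d / 2 + 1 + 1 by ring, g1, g2]
      have : Real.Gamma ((d : ℝ) / 2 + 1) ≠ 0 := (Real.Gamma_pos_of_pos (by positivity)).ne'
      field_simp
      ring

lemma risingFactorial_succ (a : ℝ) (s : ℕ) :
    risingFactorial a (s + 1) = risingFactorial a s * (a + s) := Finset.prod_range_succ _ _

lemma gegenbauer_eval_one (ν : ℝ) (m : ℕ) :
    (gegenbauer ν m).eval 1 = risingFactorial (2 * ν) m / m.factorial := by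
  induction m using Nat.twoStepInduction with
  | zero => simp [gegenbauer, risingFactorial]
  | one => simp [gegenbauer, risingFactorial]
  | more m h0 h1 =>
    simp only [gegenbauer, eval_mul, eval_C, eval_sub, eval_X, h0, h1, risingFactorial_succ,
      Nat.factorial_succ]
    have : (m.factorial : ℝ) ≠ 0 := by positivity
    push_cast
    have : (m : ℝ) + 2 ≠ 0 := by positivity
    have : (m : ℝ) + 1 + 1 ≠ 0 := by positivity
    field_simp
    ring

lemma gegenbauerNormSq_eq (hd : 1 ≤ d) (m : ℕ) :
    gegenbauerNormSq m ((d : ℝ) / 2) = weightInt hd 1 *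
      ((d : ℝ) / 2 / (m + d / 2) * (gegenbauer ((d : ℝ) / 2) m).eval 1) := by
  have hd' : (1 : ℝ) ≤ d := by exact_mod_cast hd
  have hν : (d : ℝ) / 2 ≠ 0 := by positivity
  rw [gegenbauer_eval_one, weightInt_one, gegenbauerNormSq, Real.Gamma_add_one hν]
  have h1 : Real.Gamma ((d : ℝ) / 2) ≠ 0 := (Real.Gamma_pos_of_pos (by positivity)).ne'
  have h2 : (m.factorial : ℝ) ≠ 0 := by positivity
  have h3 : (m : ℝ) + d / 2 ≠ 0 := by positivity
  field_simp

/-- The ball orthogonality with both directions equal, carried to the interval. -/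
lemma weightInt_gegenbauer_mul (hd : 1 ≤ d) (k m : ℕ) :
    weightInt hd (gegenbauer ((d : ℝ) / 2) k * gegenbauer ((d : ℝ) / 2) m) =
      if k = m then gegenbauerNormSq m ((d : ℝ) / 2) else 0 := by
  obtain ⟨-, ξ, -⟩ := exists_smul_sphere hd 0
  refine mul_left_cancel₀ (ballInt_one_pos (d := d)).ne' ?_
  rw [ballInt_one_mul_weightInt hd ξ, map_mul, ballInt_gegenbauer_mul_gegenbauer hd,
    real_inner_self_eq_norm_sq, norm_eq_of_mem_sphere, one_pow]
  split_ifs with h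
  · rw [gegenbauerNormSq_eq hd]; ring
  · simp

lemma gegenbauerNormSq_pos (hd : 1 ≤ d) (m : ℕ) : 0 < gegenbauerNormSq m ((d : ℝ) / 2) := by
  have hd' : (1 : ℝ) ≤ d := by exact_mod_cast hd
  have h1 : 0 < Real.Gamma ((d : ℝ) / 2) := Real.Gamma_pos_of_pos (by positivity)
  have h2 : 0 < Real.Gamma ((d : ℝ) / 2 + 1 / 2) := Real.Gamma_pos_of_pos (by positivity)
  have h3 : 0 < risingFactorial (2 * ((d : ℝ) / 2)) m := Finset.prod_pos fun i _ => by positivity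
  have h4 := Real.pi_pos
  unfold gegenbauerNormSq
  positivity

lemma weightInt_U_mul_U (hd : 1 ≤ d) (k m : ℕ) :
    weightInt hd (U d k * U d m) = if k = m then 1 else 0 := by
  have e : U d k * U d m = ((√(gegenbauerNormSq k ((d : ℝ) / 2)))⁻¹ *
      (√(gegenbauerNormSq m ((d : ℝ) / 2)))⁻¹) •
      (gegenbauer ((d : ℝ) / 2) k * gegenbauer ((d : ℝ) / 2) m) := by
    simp only [U, Polynomial.smul_eq_C_mul, map_mul]; ring
  rw [e, map_smul, weightInt_gegenbauer_mul, smul_eq_mul]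
  split_ifs with h
  · subst h
    have := gegenbauerNormSq_pos hd k
    rw [← mul_inv, Real.mul_self_sqrt this.le, inv_mul_cancel₀ this.ne']
  · simp

/-! ### Linear functionals on ridge polynomials -/

lemma linForm_mul_eq_sum (ξ : Fin d → ℝ) (q : MvPolynomial (Fin d) ℝ)
    (φ : MvPolynomial (Fin d) ℝ →ₗ[ℝ] ℝ) :
    φ (linForm ξ * q) = ∑ i, ξ i * φ (MvPolynomial.X i * q) := by
  simp only [linForm, Finset.sum_mul, map_sum, ← MvPolynomial.smul_eq_C_mul, map_smul,
    smul_mul_assoc, smul_eq_mul]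

lemma aeval_gegenbauer_add_two (ν : ℝ) (ℓ : MvPolynomial (Fin d) ℝ) (m : ℕ) :
    aeval ℓ (gegenbauer ν (m + 2)) = ((m : ℝ) + 2)⁻¹ • ((2 * ((m : ℝ) + 1 + ν)) •
      (ℓ * aeval ℓ (gegenbauer ν (m + 1))) - ((m : ℝ) + 2 * ν) • aeval ℓ (gegenbauer ν m)) := by
  rw [gegenbauer]
  simp only [map_mul, map_sub, aeval_C, aeval_X, ← Algebra.smul_def, mul_assoc, mul_smul]

/-- The recurrence changes the degree in steps of equal parity, and |ξ|² = 1 on the sphere fills the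
gap of two. An arbitrary functional φ covers at once evaluation at a point and integration against a
polynomial, and is needed in the induction, where φ is composed with multiplication by X_i. -/
lemma exists_isHomogeneous_gegenbauer (ν : ℝ) (k : ℕ) (φ : MvPolynomial (Fin d) ℝ →ₗ[ℝ] ℝ) :
    ∃ a : MvPolynomial (Fin d) ℝ, a.IsHomogeneous k ∧
      ∀ ξ : S d, polyFun a (ξ : E d) = φ (aeval (linForm (ξ : E d).ofLp) (gegenbauer ν k)) := by
  induction k using Nat.twoStepInduction generalizing φ with
  | zero =>
    exact ⟨MvPolynomial.C (φ 1), MvPolynomial.isHomogeneous_C _ _, fun ξ => by simp [gegenbauer]⟩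
  | one =>
    refine ⟨(2 * ν) • linForm fun i => φ (MvPolynomial.X i * 1), ?_, fun ξ => ?_⟩
    · rw [MvPolynomial.smul_eq_C_mul]
      exact (linForm_isHomogeneous _).C_mul _
    · have := linForm_mul_eq_sum (ξ : E d).ofLp 1 φ
      rw [mul_one] at this
      rw [polyFun_smul, polyFun_linForm, gegenbauer, map_mul, aeval_C, aeval_X, ← Algebra.smul_def,
        map_smul, this, smul_eq_mul]
      simp [mul_comm]
  | more m h0 h1 =>
    obtain ⟨b, hb, hb'⟩ := h0 φ
    choose a ha ha' using fun i : Fin d => h1 (φ ∘ₗ LinearMap.mulLeft ℝ (MvPolynomial.X i))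
    refine ⟨((m : ℝ) + 2)⁻¹ • ((2 * ((m : ℝ) + 1 + ν)) • (∑ i, MvPolynomial.X i * a i)
      - ((m : ℝ) + 2 * ν) • (quadForm d * b)), ?_, fun ξ => ?_⟩
    · simp only [MvPolynomial.smul_eq_C_mul]
      refine (MvPolynomial.IsHomogeneous.sub ?_ ?_).C_mul _
      · refine MvPolynomial.IsHomogeneous.C_mul (.sum _ _ _ fun i _ => ?_) _
        have := (MvPolynomial.isHomogeneous_X ℝ i).mul (ha i)
        rwa [show 1 + (m + 1) = m + 2 by ring] at this
      · have := ((quadForm_isHomogeneous (D := d)).mul hb).C_mul ((m : ℝ) + 2 * ν)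
        rwa [add_comm 2 m] at this
    · simp only [aeval_gegenbauer_add_two, polyFun_smul, polyFun_sub, polyFun_sum, polyFun_mul,
        polyFun_X, polyFun_quadForm_sphere, hb', ha', map_smul, map_sub, linForm_mul_eq_sum,
        LinearMap.comp_apply, LinearMap.mulLeft_apply, smul_eq_mul, one_mul]

/-- Powers of linear forms span the homogeneous polynomials. -/
lemma linearMap_eq_zero_of_linForm_pow (φ : MvPolynomial (Fin d) ℝ →ₗ[ℝ] ℝ) {m : ℕ}
    (h : ∀ η, φ (linForm η ^ m) = 0) {p : MvPolynomial (Fin d) ℝ} (hp : p.IsHomogeneous m) :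
    φ p = 0 := by
  induction m generalizing φ p with
  | zero =>
    rw [MvPolynomial.totalDegree_eq_zero_iff_eq_C.1
      ((MvPolynomial.totalDegree_zero_iff_isHomogeneous _).2 hp), ← mul_one (MvPolynomial.C _),
      ← MvPolynomial.smul_eq_C_mul, map_smul, ← pow_zero (linForm 0), h, smul_zero]
  | succ m ih =>
    have hi : ∀ i, φ (MvPolynomial.X i * MvPolynomial.pderiv i p) = 0 := by
      intro i
      refine ih (φ ∘ₗ LinearMap.mulLeft ℝ (MvPolynomial.X i)) (fun η => ?_)
        (pderiv_isHomogeneous_succ hp i)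
      let c : ℕ → ℝ := fun k =>
        φ (MvPolynomial.X i ^ k * linForm η ^ (m + 1 - k) * ((m + 1).choose k : MvPolynomial (Fin d) ℝ))
      -- Polarisation: φ((s X_i + η·x)^{m+1}) is a polynomial in s that vanishes identically, so its
      -- coefficient of s, a multiple of φ(X_i (η·x)^m), is zero.
      have hpoly : ∑ k ∈ Finset.range (m + 1 + 1), C (c k) * (X : ℝ[X]) ^ k = 0 := by
        refine Polynomial.funext fun s => ?_
        have hs := h (s • Pi.single i 1 + η)
        have e : linForm (s • Pi.single i 1 + η) = s • MvPolynomial.X i + linForm η := by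
          simp [linForm, add_mul, Finset.sum_add_distrib, Pi.single_apply,
            apply_ite MvPolynomial.C, MvPolynomial.smul_eq_C_mul]
        rw [e, add_pow, map_sum] at hs
        rw [eval_zero, eval_finsetSum, ← hs]
        refine Finset.sum_congr rfl fun k _ => ?_
        rw [_root_.smul_pow, smul_mul_assoc, smul_mul_assoc, map_smul]
        rw [eval_mul, eval_C, eval_pow, eval_X, smul_eq_mul, mul_comm]
      have h1 := congrArg (fun q => Polynomial.coeff q 1) hpoly
      simp only [finsetSum_coeff, coeff_C_mul, coeff_X_pow, coeff_zero] at h1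
      rw [Finset.sum_eq_single 1 (fun k _ hk => by simp [Ne.symm hk]) (by simp)] at h1
      simp only [c, pow_one, Nat.choose_one_right, Nat.add_sub_cancel, if_true, mul_one] at h1
      rw [mul_comm _ ((m + 1 : ℕ) : MvPolynomial (Fin d) ℝ), ← nsmul_eq_mul,
        ← Nat.cast_smul_eq_nsmul ℝ, map_smul] at h1
      exact (smul_eq_zero.1 h1).resolve_left (by positivity)
    have he := congrArg φ hp.sum_X_mul_pderiv
    rw [← Nat.cast_smul_eq_nsmul ℝ, map_smul, map_sum, Finset.sum_eq_zero fun k _ => hi k] at he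
    exact (smul_eq_zero.1 he.symm).resolve_left (by positivity)

/-- The recurrence solves for t G_{i+1} in terms of G_{i+2} and G_i, so powers of t can be built up
one at a time while i + j ≤ s. Positivity of ν allows the division. -/
lemma linearMap_X_pow_eq_zero {ν : ℝ} (hν : 0 < ν) (ψ : ℝ[X] →ₗ[ℝ] ℝ) {s : ℕ}
    (h : ∀ m ≤ s, ψ (gegenbauer ν m) = 0) {m : ℕ} (hm : m ≤ s) : ψ (X ^ m) = 0 := by
  have key : ∀ j i, i + j ≤ s → ψ (X ^ j * gegenbauer ν i) = 0 := by
    intro j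
    induction j with
    | zero => intro i hi; simpa using h i hi
    | succ j ih =>
      intro i hi
      cases i with
      | zero =>
        have h1 := ih 1 (by omega)
        have e : X ^ j * gegenbauer ν 1 = (2 * ν) • (X ^ (j + 1) * gegenbauer ν 0) := by
          simp only [gegenbauer, Polynomial.smul_eq_C_mul]; ring
        rw [e, map_smul] at h1
        exact (smul_eq_zero.1 h1).resolve_left (by positivity)
      | succ i =>
        have h2 := ih (i + 2) (by omega)
        have h0 := ih i (by omega)
        have e : X ^ j * gegenbauer ν (i + 2) = ((i : ℝ) + 2)⁻¹ • ((2 * ((i : ℝ) + 1 + ν)) •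
            (X ^ (j + 1) * gegenbauer ν (i + 1)) - ((i : ℝ) + 2 * ν) • (X ^ j * gegenbauer ν i)) := by
          rw [gegenbauer]; simp only [Polynomial.smul_eq_C_mul]; ring
        rw [e, map_smul, map_sub, map_smul, map_smul, h0, smul_zero, sub_zero] at h2
        exact (smul_eq_zero.1 ((smul_eq_zero.1 h2).resolve_left (by positivity))).resolve_left
          (by positivity)
  simpa [gegenbauer] using key m 0 (by omega)

lemma linForm_smul (r : ℝ) (η : Fin d → ℝ) : linForm (r • η) = r • linForm η := by
  simp [linForm, Finset.smul_sum, MvPolynomial.smul_eq_C_mul, mul_assoc]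

/-- Ridge Gegenbauer polynomials of degree at most s span all polynomials of degree at most s, so a
linear identity need only be tested on them. -/
lemma linearMap_eq_zero_of_gegenbauer (hd : 1 ≤ d) {ν : ℝ} (hν : 0 < ν)
    (φ : MvPolynomial (Fin d) ℝ →ₗ[ℝ] ℝ) {s : ℕ}
    (h : ∀ m ≤ s, ∀ η : S d, φ (aeval (linForm (η : E d).ofLp) (gegenbauer ν m)) = 0)
    {P : MvPolynomial (Fin d) ℝ} (hP : P.totalDegree ≤ s) : φ P = 0 := by
  refine linearMap_eq_zero_of_homogeneous φ hP fun m hm p hp =>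
    linearMap_eq_zero_of_linForm_pow φ (fun η => ?_) hp
  obtain ⟨r, e, he⟩ := exists_smul_sphere hd (WithLp.toLp 2 η)
  have hη : η = r • (e : E d).ofLp := congrArg WithLp.ofLp he
  have h0 := linearMap_X_pow_eq_zero hν (φ ∘ₗ (aeval (linForm (e : E d).ofLp)).toLinearMap)
    (fun m hm => h m hm e) hm
  rw [hη, linForm_smul, _root_.smul_pow, map_smul]
  simp only [LinearMap.comp_apply, AlgHom.toLinearMap_apply, map_pow, aeval_X] at h0
  rw [h0, smul_zero]

/-! ### The reproducing identity -/

/-- The coefficient `∫_{𝔹^d} U_k(ξ · y) P(y) dy` of a polynomial along the direction `ξ`. -/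
def ridgeCoeff (d k : ℕ) (P : MvPolynomial (Fin d) ℝ) (ξ : S d) : ℝ :=
  ballInt d (aeval (linForm (ξ : E d).ofLp) (U d k) * P)

lemma aeval_U (k : ℕ) (ℓ : MvPolynomial (Fin d) ℝ) :
    aeval ℓ (U d k) = (√(gegenbauerNormSq k ((d : ℝ) / 2)))⁻¹ •
      aeval ℓ (gegenbauer ((d : ℝ) / 2) k) := by
  rw [U, map_mul, aeval_C, ← Algebra.smul_def]

lemma exists_isHomogeneous_U (k : ℕ) (φ : MvPolynomial (Fin d) ℝ →ₗ[ℝ] ℝ) :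
    ∃ a : MvPolynomial (Fin d) ℝ, a.IsHomogeneous k ∧
      ∀ ξ : S d, polyFun a (ξ : E d) = φ (aeval (linForm (ξ : E d).ofLp) (U d k)) := by
  obtain ⟨a, ha, ha'⟩ := exists_isHomogeneous_gegenbauer ((d : ℝ) / 2) k φ
  refine ⟨MvPolynomial.C (√(gegenbauerNormSq k ((d : ℝ) / 2)))⁻¹ * a, ha.C_mul _, fun ξ => ?_⟩
  rw [← MvPolynomial.smul_eq_C_mul, polyFun_smul, ha', aeval_U, map_smul, smul_eq_mul]

lemma exists_ridgeCoeff (k : ℕ) (P : MvPolynomial (Fin d) ℝ) :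
    ∃ a : MvPolynomial (Fin d) ℝ, a.IsHomogeneous k ∧
      ∀ ξ : S d, polyFun a (ξ : E d) = ridgeCoeff d k P ξ := by
  obtain ⟨a, ha, ha'⟩ := exists_isHomogeneous_U k (ballInt d ∘ₗ LinearMap.mulRight ℝ P)
  exact ⟨a, ha, ha'⟩

lemma exists_U_inner (k : ℕ) (x : E d) :
    ∃ a : MvPolynomial (Fin d) ℝ, a.IsHomogeneous k ∧
      ∀ ξ : S d, polyFun a (ξ : E d) = (U d k).eval (inner ℝ (ξ : E d) x) := by
  obtain ⟨a, ha, ha'⟩ := exists_isHomogeneous_U k (MvPolynomial.aeval fun i => x i).toLinearMap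
  exact ⟨a, ha, fun ξ => by rw [ha', ← polyFun_ridge]; rfl⟩

lemma continuous_ridgeCoeff (k : ℕ) (P : MvPolynomial (Fin d) ℝ) :
    Continuous (ridgeCoeff d k P) := by
  obtain ⟨a, -, ha⟩ := exists_ridgeCoeff k P
  rw [show ridgeCoeff d k P = fun ξ : S d => polyFun a (ξ : E d) from funext fun ξ => (ha ξ).symm]
  exact continuous_polyFun_sphere a

lemma ridgeCoeff_of_lt (hd : 1 ≤ d) {k : ℕ} {P : MvPolynomial (Fin d) ℝ} (hP : P.totalDegree < k)
    (ξ : S d) : ridgeCoeff d k P ξ = 0 := by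
  rw [ridgeCoeff, aeval_U, smul_mul_assoc, map_smul,
    ballInt_gegenbauer_mul_of_lt hd (sum_sq_sphere ξ) hP, smul_zero]

/-- The reproducing property in ξ, applied to a homogeneous polynomial agreeing with ξ ↦ G_m(ξ·x) on
the sphere. -/
lemma integral_gegenbauer_mul (hd : 1 ≤ d) (m : ℕ) (η : S d) (x : E d) :
    ∫ ξ, (gegenbauer ((d : ℝ) / 2) m).eval (inner ℝ (ξ : E d) x) *
        (gegenbauer ((d : ℝ) / 2) m).eval (inner ℝ (ξ : E d) (η : E d)) ∂(surfaceMeasure d) =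
      sphereInt d 1 * (gegenbauer ((d : ℝ) / 2) m).eval (inner ℝ (η : E d) x) := by
  obtain ⟨a, ha, ha'⟩ := exists_isHomogeneous_gegenbauer ((d : ℝ) / 2) m
    (MvPolynomial.aeval fun i => x i).toLinearMap
  have ha'' : ∀ ξ : S d, polyFun a (ξ : E d)
      = (gegenbauer ((d : ℝ) / 2) m).eval (inner ℝ (ξ : E d) x) :=
    fun ξ => by rw [ha', ← polyFun_ridge]; rfl
  have h := sphereInt_homGegenbauer_mul_eq_eval hd (ν := (d : ℝ) / 2) (by ring)
    (sum_sq_sphere η) ha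
  rw [sphereInt_apply] at h
  rw [← ha'' η, polyFun, ← h]
  refine integral_congr_ae (.of_forall fun ξ => ?_)
  simp only
  rw [polyFun_mul, polyFun_homGegenbauer_sphere, polyFun_ridge, ha'', mul_comm, real_inner_comm]

lemma risingFactorial_mul_factorial (a n : ℕ) :
    risingFactorial ((a : ℝ) + 1) n * a.factorial = (a + n).factorial := by
  induction n with
  | zero => simp [risingFactorial]
  | succ n ih =>
    rw [risingFactorial_succ, ← add_assoc, Nat.factorial_succ]
    push_cast
    rw [← ih]
    ring

lemma v_sq (k : ℕ) :
    v d k ^ 2 = risingFactorial ((k : ℝ) + 1) (d - 1) / (2 * (2 * Real.pi) ^ (d - 1)) := by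
  rw [v, Real.sq_sqrt]
  have : 0 ≤ risingFactorial ((k : ℝ) + 1) (d - 1) := Finset.prod_nonneg fun i _ => by positivity
  positivity

lemma ballInt_one_eq (hd : 1 ≤ d) :
    ballInt d 1 = √Real.pi ^ d / Real.Gamma ((d : ℝ) / 2 + 1) := by
  have : Nonempty (Fin d) := ⟨⟨0, hd⟩⟩
  rw [ballInt_one, measureReal_def, EuclideanSpace.volume_ball]
  simp only [ENNReal.ofReal_one, one_pow, one_mul, Fintype.card_fin]
  exact ENNReal.toReal_ofReal (div_nonneg (by positivity) (Real.Gamma_nonneg_of_nonneg (by positivity)))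

/-- This identity dictates the value of v_k: it is the total constant from the ball and sphere
integrals. The Gamma factors collapse by Legendre's duplication formula at d/2. -/
lemma v_sq_normalization (hd : 1 ≤ d) (m : ℕ) :
    v d m ^ 2 * (gegenbauerNormSq m ((d : ℝ) / 2))⁻¹ * ((d : ℝ) / 2 / (m + d / 2) * ballInt d 1)
      * sphereInt d 1 = 1 := by
  obtain ⟨n, rfl⟩ : ∃ n, d = n + 1 := ⟨d - 1, by omega⟩
  have hν : (0 : ℝ) < ((n + 1 : ℕ) : ℝ) / 2 := by positivity
  have hG := Real.Gamma_mul_Gamma_add_half (((n + 1 : ℕ) : ℝ) / 2)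
  have hfac : Real.Gamma (2 * (((n + 1 : ℕ) : ℝ) / 2)) = n.factorial := by
    rw [mul_div_cancel₀ _ two_ne_zero]; push_cast; exact Real.Gamma_nat_eq_factorial n
  have hpow : (2 : ℝ) ^ (1 - 2 * (((n + 1 : ℕ) : ℝ) / 2)) = (2 ^ n)⁻¹ := by
    rw [show 1 - 2 * (((n + 1 : ℕ) : ℝ) / 2) = -(n : ℝ) by push_cast; ring,
      Real.rpow_neg two_pos.le, Real.rpow_natCast]
  rw [hfac, hpow] at hG
  have r1 := risingFactorial_mul_factorial m n
  have r2 := risingFactorial_mul_factorial n m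
  rw [add_comm n m, ← r1] at r2
  rw [sphereInt_one, ballInt_one_eq hd, Real.Gamma_add_one hν.ne', v_sq, gegenbauerNormSq,
    Nat.add_sub_cancel]
  have e : 2 * (((n + 1 : ℕ) : ℝ) / 2) = (n : ℝ) + 1 := by push_cast; ring
  rw [e]
  have g1 : Real.Gamma (((n + 1 : ℕ) : ℝ) / 2) ≠ 0 := (Real.Gamma_pos_of_pos hν).ne'
  have g2 : Real.Gamma (((n + 1 : ℕ) : ℝ) / 2 + 1 / 2) ≠ 0 :=
    (Real.Gamma_pos_of_pos (by positivity)).ne'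
  have hr2 : risingFactorial ((n : ℝ) + 1) m ≠ 0 :=
    (Finset.prod_pos fun i _ => by positivity).ne'
  have hsp : √Real.pi ≠ 0 := (Real.sqrt_pos.2 Real.pi_pos).ne'
  have hsq : Real.pi = √Real.pi ^ 2 := (Real.sq_sqrt Real.pi_pos.le).symm
  have hm : (m : ℝ) + ((n + 1 : ℕ) : ℝ) / 2 ≠ 0 := by positivity
  have hmf : (m.factorial : ℝ) ≠ 0 := by positivity
  have hnf : (n.factorial : ℝ) ≠ 0 := by positivity
  generalize risingFactorial ((n : ℝ) + 1) m = R2 at *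
  generalize risingFactorial ((m : ℝ) + 1) n = R1 at *
  generalize Real.Gamma (((n + 1 : ℕ) : ℝ) / 2 + 1 / 2) = G2 at *
  generalize Real.Gamma (((n + 1 : ℕ) : ℝ) / 2) = G1 at *
  have hR : R1 = R2 * n.factorial / m.factorial := by field_simp; linarith
  have hG2 : G2 = n.factorial * (2 ^ n)⁻¹ * √Real.pi / G1 := by field_simp at hG ⊢; linarith
  rw [hR, hG2]
  generalize √Real.pi = p at *
  rw [hsq]
  push_cast at *
  field_simp
  rw [mul_pow]
  ring

/-- Both sides are linear in P, so P may be a ridge Gegenbauer polynomial of degree m in a direction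
η. Orthogonality on the ball leaves only k = m, where A_m(ξ) is a multiple of G_m(ξ·η); the sphere
integral then returns G_m(η·x), with total constant 1. -/
lemma polyFun_eq_sum_integral (hd : 1 ≤ d) {s : ℕ} {P : MvPolynomial (Fin d) ℝ}
    (hP : P.totalDegree ≤ s) (x : E d) :
    polyFun P x = ∑ k ∈ Finset.range (s + 1), v d k ^ 2 *
      ∫ ξ, (U d k).eval (inner ℝ (ξ : E d) x) * ridgeCoeff d k P ξ ∂(surfaceMeasure d) := by
  have hcont : ∀ k, Continuous fun ξ : S d => (U d k).eval (inner ℝ (ξ : E d) x) := fun k =>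
    (U d k).continuous.comp (by fun_prop)
  have hint : ∀ k P, Integrable
      (fun ξ : S d => (U d k).eval (inner ℝ (ξ : E d) x) * ridgeCoeff d k P ξ) (surfaceMeasure d) :=
    fun k P => ((hcont k).mul (continuous_ridgeCoeff k P)).integrable_of_hasCompactSupport
      (HasCompactSupport.of_compactSpace _)
  let Φ : ℕ → MvPolynomial (Fin d) ℝ →ₗ[ℝ] ℝ := fun k =>
    { toFun := fun P =>
        ∫ ξ, (U d k).eval (inner ℝ (ξ : E d) x) * ridgeCoeff d k P ξ ∂(surfaceMeasure d)
      map_add' := fun P Q => by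
        rw [← integral_add (hint k P) (hint k Q)]
        simp only [ridgeCoeff, mul_add, map_add]
      map_smul' := fun c P => by
        simp only [ridgeCoeff, mul_smul_comm, map_smul, smul_eq_mul, RingHom.id_apply]
        rw [← integral_const_mul]
        congr 1 with ξ
        ring }
  let φ : MvPolynomial (Fin d) ℝ →ₗ[ℝ] ℝ := (MvPolynomial.aeval fun i => x i).toLinearMap
    - ∑ k ∈ Finset.range (s + 1), v d k ^ 2 • Φ k
  have hφ : ∀ Q, φ Q = polyFun Q x - ∑ k ∈ Finset.range (s + 1), v d k ^ 2 *
      ∫ ξ, (U d k).eval (inner ℝ (ξ : E d) x) * ridgeCoeff d k Q ξ ∂(surfaceMeasure d) := by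
    intro Q
    simp only [φ, LinearMap.sub_apply, LinearMap.sum_apply, LinearMap.smul_apply, smul_eq_mul]
    rfl
  have hd' : (0 : ℝ) < d := by exact_mod_cast hd
  have h0 := linearMap_eq_zero_of_gegenbauer hd (ν := (d : ℝ) / 2) (by positivity) φ (s := s)
    (fun m hm η => ?_) hP
  · rw [hφ] at h0
    linarith
  rw [hφ, Finset.sum_eq_single m]
  · have e : ∀ ξ : S d, (U d m).eval (inner ℝ (ξ : E d) x) *
        ridgeCoeff d m (aeval (linForm (η : E d).ofLp) (gegenbauer ((d : ℝ) / 2) m)) ξ =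
        ((gegenbauerNormSq m ((d : ℝ) / 2))⁻¹ * ((d : ℝ) / 2 / (m + d / 2) * ballInt d 1)) *
        ((gegenbauer ((d : ℝ) / 2) m).eval (inner ℝ (ξ : E d) x) *
          (gegenbauer ((d : ℝ) / 2) m).eval (inner ℝ (ξ : E d) (η : E d))) := by
      intro ξ
      rw [ridgeCoeff, aeval_U, smul_mul_assoc, map_smul, ballInt_gegenbauer_mul_gegenbauer hd,
        if_pos rfl, U, eval_mul, eval_C, smul_eq_mul]
      have := Real.mul_self_sqrt (gegenbauerNormSq_pos hd m).le
      have h2 : (gegenbauerNormSq m ((d : ℝ) / 2))⁻¹ = (√(gegenbauerNormSq m ((d : ℝ) / 2)))⁻¹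
          * (√(gegenbauerNormSq m ((d : ℝ) / 2)))⁻¹ := by rw [← mul_inv, this]
      rw [h2]
      ring
    simp only [e, integral_const_mul, integral_gegenbauer_mul hd, polyFun_ridge]
    linear_combination (-(gegenbauer ((d : ℝ) / 2) m).eval (inner ℝ (η : E d) x))
      * v_sq_normalization hd m
  · intro k _ hk
    have : ∀ ξ, ridgeCoeff d k
        (aeval (linForm (η : E d).ofLp) (gegenbauer ((d : ℝ) / 2) m)) ξ = 0 := by
      intro ξ
      rw [ridgeCoeff, aeval_U, smul_mul_assoc, map_smul, ballInt_gegenbauer_mul_gegenbauer hd,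
        if_neg hk, smul_zero]
    simp [this]
  · intro h
    exact absurd (Finset.mem_range.2 (by omega)) h

/-! ### Parseval's identity on the sphere -/

section Parseval

variable {Y : (j : ℕ) → Fin (harmonicDim d j) → S d → ℝ}

lemma IsHarmonicONB.exists_harmonic (hY : IsHarmonicONB d Y) (j : ℕ) (i : Fin (harmonicDim d j)) :
    ∃ y : MvPolynomial (Fin d) ℝ, y.IsHomogeneous j ∧ polyLaplacian d y = 0 ∧
      ∀ ξ : S d, polyFun y (ξ : E d) = Y j i ξ := by
  have h : Y j i ∈ sphericalHarmonics d j := by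
    rw [← hY.span_eq]; exact Submodule.subset_span ⟨i, rfl⟩
  obtain ⟨y, ⟨hy, hΔ⟩, h⟩ := h
  exact ⟨y, hy, hΔ, fun ξ => congrFun h ξ⟩

lemma IsHarmonicONB.parseval_harmonic (hY : IsHarmonicONB d Y) {j : ℕ}
    {y : Fin (harmonicDim d j) → MvPolynomial (Fin d) ℝ}
    (hy : ∀ i, ∀ ξ : S d, polyFun (y i) (ξ : E d) = Y j i ξ)
    {h : MvPolynomial (Fin d) ℝ} (hh : h.IsHomogeneous j) (hΔ : polyLaplacian d h = 0) :
    sphereInt d (h * h) = ∑ i, sphereInt d (y i * h) ^ 2 := by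
  have hmem : restrictSphere d h ∈ sphericalHarmonics d j := ⟨h, ⟨hh, hΔ⟩, rfl⟩
  rw [← hY.span_eq, Submodule.mem_span_range_iff_exists_fun] at hmem
  obtain ⟨c, hc⟩ := hmem
  have hc' : ∀ q, sphereInt d (q * h) = ∑ i, c i * sphereInt d (q * y i) := by
    intro q
    rw [sphereInt_congr (q := ∑ i, c i • (q * y i)), map_sum]
    · simp
    · intro ξ
      have := congrFun hc ξ
      have h2 : polyFun h (ξ : E d) = ∑ i, c i * Y j i ξ := by
        rw [show polyFun h (ξ : E d) = restrictSphere d h ξ from rfl, ← this]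
        simp
      rw [polyFun_mul, h2, polyFun_sum, Finset.mul_sum]
      refine Finset.sum_congr rfl fun i _ => ?_
      rw [polyFun_smul, polyFun_mul, hy]
      ring
  have ho : ∀ i i', sphereInt d (y i * y i') = if i = i' then 1 else 0 := by
    intro i i'
    rw [← hY.orthonormal j i i', sphereInt_apply]
    simp only [polyFun_mul, hy]
  have hi : ∀ i, sphereInt d (y i * h) = c i := by
    intro i
    rw [hc']
    simp [ho]
  rw [hc']
  refine Finset.sum_congr rfl fun i _ => ?_
  rw [mul_comm h, hi, sq]

lemma parityIndices_add_two (k : ℕ) : parityIndices (k + 2) = insert (k + 2) (parityIndices k) := by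
  ext j
  simp only [parityIndices, Finset.mem_filter, Finset.mem_range, Finset.mem_insert]
  omega

lemma le_of_mem_parityIndices {j k : ℕ} (h : j ∈ parityIndices k) : j ≤ k := by
  simp only [parityIndices, Finset.mem_filter, Finset.mem_range] at h
  omega

/-- Split q = h + |x|² r with h harmonic. On the sphere h and r are orthogonal; h accounts for the
top degree and r, by induction, for the lower degrees of the same parity. -/
lemma IsHarmonicONB.parseval (hd : 1 ≤ d) (hY : IsHarmonicONB d Y) {k : ℕ}
    {q : MvPolynomial (Fin d) ℝ} (hq : q.IsHomogeneous k) :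
    sphereInt d (q * q) = ∑ j ∈ parityIndices k, ∑ i : Fin (harmonicDim d j),
      (∫ ξ, Y j i ξ * polyFun q (ξ : E d) ∂(surfaceMeasure d)) ^ 2 := by
  choose y hyh hyΔ hy using hY.exists_harmonic
  have e : ∀ j i q, ∫ ξ, Y j i ξ * polyFun q (ξ : E d) ∂(surfaceMeasure d)
      = sphereInt d (y j i * q) := by
    intro j i q
    simp only [sphereInt_apply, polyFun_mul, hy]
  simp only [e]
  induction k using Nat.twoStepInduction generalizing q with
  | zero =>
    rw [show parityIndices 0 = {0} from rfl, Finset.sum_singleton]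
    exact hY.parseval_harmonic (hy 0) hq (polyLaplacian_of_isHomogeneous_le_one zero_le_one hq)
  | one =>
    rw [show parityIndices 1 = {1} from rfl, Finset.sum_singleton]
    exact hY.parseval_harmonic (hy 1) hq (polyLaplacian_of_isHomogeneous_le_one le_rfl hq)
  | more k h0 _ =>
    obtain ⟨h, r, hh, hΔ, hr, rfl⟩ := exists_harmonic_add_quadForm_mul hd hq
    have hs : ∀ p, sphereInt d (p * (h + quadForm d * r))
        = sphereInt d (p * h) + sphereInt d (p * r) := by
      intro p
      rw [mul_add, map_add, mul_left_comm, sphereInt_quadForm_mul]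
    have hhr : sphereInt d (h * r) = 0 := sphereInt_harmonic_mul hd (by omega) hh hΔ hr
    have hq2 : sphereInt d ((h + quadForm d * r) * (h + quadForm d * r))
        = sphereInt d (h * h) + sphereInt d (r * r) := by
      rw [hs, mul_comm _ h, hs, hhr, mul_comm _ r, hs, mul_comm r h, hhr]
      ring
    have hnot : k + 2 ∉ parityIndices k := fun h => by
      have := le_of_mem_parityIndices h; omega
    rw [hq2, parityIndices_add_two, Finset.sum_insert hnot,
      hY.parseval_harmonic (hy (k + 2)) hh hΔ, h0 hr]
    congr 1
    · refine Finset.sum_congr rfl fun i _ => ?_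
      rw [hs, sphereInt_harmonic_mul hd (by omega) (hyh (k + 2) i) (hyΔ (k + 2) i) hr, add_zero]
    · refine Finset.sum_congr rfl fun j hj => Finset.sum_congr rfl fun i _ => ?_
      have := le_of_mem_parityIndices hj
      rw [hs, mul_comm (y j i) h, sphereInt_harmonic_mul hd (by omega) hh hΔ (hyh j i), zero_add]

/-! ### The coefficients on the ball -/

lemma ridgeCoeff_eq_integral (k : ℕ) (P : MvPolynomial (Fin d) ℝ) (ξ : S d) :
    ∫ y in unitBall d, (U d k).eval (inner ℝ (ξ : E d) y) * polyFun P y = ridgeCoeff d k P ξ := by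
  simp only [ridgeCoeff, ballInt_apply, polyFun_mul, polyFun_ridge]

lemma IsHarmonicONB.continuous (hY : IsHarmonicONB d Y) (j : ℕ) (i : Fin (harmonicDim d j)) :
    Continuous (Y j i) := by
  obtain ⟨y, -, -, hy⟩ := hY.exists_harmonic j i
  rw [← show (fun ξ : S d => polyFun y (ξ : E d)) = Y j i from funext hy]
  exact continuous_polyFun_sphere y

/-- By Fubini, the ball coefficients are the spherical harmonic coefficients of A_k times v_k. -/
lemma IsHarmonicONB.coeffBall_eq (hY : IsHarmonicONB d Y) (P : MvPolynomial (Fin d) ℝ) (k j : ℕ)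
    (i : Fin (harmonicDim d j)) :
    coeffBall d Y (polyFun P) k j i =
      v d k * ∫ ξ, Y j i ξ * ridgeCoeff d k P ξ ∂(surfaceMeasure d) := by
  have hF : Continuous fun p : E d × S d =>
      polyFun P p.1 * (Y j i p.2 * (U d k).eval (inner ℝ p.1 (p.2 : E d))) := by
    have h1 := (continuous_polyFun P).comp (continuous_fst (X := E d) (Y := S d))
    have h2 := (hY.continuous j i).comp (continuous_snd (X := E d) (Y := S d))
    have h3 : Continuous fun p : E d × S d => (U d k).eval (inner ℝ p.1 (p.2 : E d)) :=
      (U d k).continuous.comp (by fun_prop)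
    exact h1.mul (h2.mul h3)
  have hint : Integrable (fun p : E d × S d =>
      polyFun P p.1 * (Y j i p.2 * (U d k).eval (inner ℝ p.1 (p.2 : E d))))
      ((volume.restrict (unitBall d)).prod (surfaceMeasure d)) := by
    have := hF.continuousOn.integrableOn_compact (μ := (volume : Measure (E d)).prod
      (surfaceMeasure d)) ((isCompact_closedBall (0 : E d) 1).prod isCompact_univ)
    rwa [IntegrableOn, ← Measure.prod_restrict, Measure.restrict_univ] at this
  have hswap := integral_integral_swap (f := fun x ξ =>
    polyFun P x * (Y j i ξ * (U d k).eval (inner ℝ x (ξ : E d)))) hint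
  have e1 : ∀ x : E d, polyFun P x * ballBasis d Y k j i x = v d k *
      ∫ ξ, polyFun P x * (Y j i ξ * (U d k).eval (inner ℝ x (ξ : E d))) ∂(surfaceMeasure d) := by
    intro x
    rw [ballBasis, integral_const_mul]
    ring
  simp only [coeffBall, e1]
  rw [integral_const_mul, hswap]
  congr 2 with ξ
  rw [← ridgeCoeff_eq_integral, ← integral_const_mul]
  congr 1 with x
  rw [real_inner_comm]
  ring

lemma IsHarmonicONB.sum_coeffBall_sq (hd : 1 ≤ d) (hY : IsHarmonicONB d Y)
    (P : MvPolynomial (Fin d) ℝ) (r : ℝ) {k : ℕ} {a : MvPolynomial (Fin d) ℝ}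
    (ha : a.IsHomogeneous k) (ha' : ∀ ξ : S d, polyFun a (ξ : E d) = ridgeCoeff d k P ξ) :
    ∑ j ∈ parityIndices k, ∑ i : Fin (harmonicDim d j),
      (((k : ℝ) + 1) ^ r * coeffBall d Y (polyFun P) k j i) ^ 2 =
      (((k : ℝ) + 1) ^ r) ^ 2 * v d k ^ 2 * sphereInt d (a * a) := by
  rw [hY.parseval hd ha, Finset.mul_sum]
  refine Finset.sum_congr rfl fun j _ => ?_
  rw [Finset.mul_sum]
  refine Finset.sum_congr rfl fun i _ => ?_
  rw [hY.coeffBall_eq]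
  simp only [ha']
  ring

end Parseval

/-! ### The ridge polynomials -/

lemma ridgePoly_eq (s : ℕ) (P : MvPolynomial (Fin d) ℝ) (ξ : S d) :
    ridgePoly d s (polyFun P) ξ =
      ∑ k ∈ Finset.range (s + 1), (v d k ^ 2 * ridgeCoeff d k P ξ) • U d k := by
  simp only [ridgePoly, ridgeCoeff_eq_integral, Polynomial.smul_eq_C_mul]

lemma coeffI_ridgePoly (hd : 1 ≤ d) (s : ℕ) (P : MvPolynomial (Fin d) ℝ) (ξ : S d) (k : ℕ) :
    coeffI d (fun t => (ridgePoly d s (polyFun P) ξ).eval t) k =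
      if k ∈ Finset.range (s + 1) then v d k ^ 2 * ridgeCoeff d k P ξ else 0 := by
  have h : coeffI d (fun t => (ridgePoly d s (polyFun P) ξ).eval t) k
      = weightInt hd (ridgePoly d s (polyFun P) ξ * U d k) := by
    simp only [coeffI, weightInt_apply, eval_mul]
  rw [h, ridgePoly_eq, Finset.sum_mul, map_sum]
  simp only [smul_mul_assoc, map_smul, weightInt_U_mul_U, smul_eq_mul, mul_ite, mul_one, mul_zero,
    Finset.sum_ite_eq']

lemma memW_ridgePoly (hd : 1 ≤ d) (α : ℝ) (s : ℕ) (P : MvPolynomial (Fin d) ℝ) (ξ : S d) :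
    MemW d α (fun t => (ridgePoly d s (polyFun P) ξ).eval t) := by
  set p := ridgePoly d s (polyFun P) ξ
  refine ⟨?_, summable_of_ne_finset_zero (s := Finset.range (s + 1)) fun k hk => ?_⟩
  · have : IsFiniteMeasure ((volume.restrict I).withDensity fun t => ENNReal.ofReal (w d t)) :=
      isFiniteMeasure_withDensity_ofReal (integrableOn_I (continuous_w hd)).2
    obtain ⟨M, hM⟩ := (isCompact_Icc (a := (-1 : ℝ)) (b := 1)).exists_bound_of_continuousOn
      p.continuous.continuousOn
    refine MemLp.of_bound p.continuous.aestronglyMeasurable M ?_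
    refine (withDensity_absolutelyContinuous _ _).ae_le ?_
    filter_upwards [ae_restrict_mem measurableSet_Icc] with t ht using hM t ht
  · rw [coeffI_ridgePoly hd, if_neg hk]
    simp

lemma normSqW_ridgePoly (hd : 1 ≤ d) (s : ℕ) (P : MvPolynomial (Fin d) ℝ) (ξ : S d) :
    normSqW d 1 (fun t => (ridgePoly d s (polyFun P) ξ).eval t) =
      ∑ k ∈ Finset.range (s + 1), (((k : ℝ) + 1) * (v d k ^ 2 * ridgeCoeff d k P ξ)) ^ 2 := by
  rw [normSqW, tsum_eq_sum (s := Finset.range (s + 1)) fun k hk => by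
    rw [coeffI_ridgePoly hd, if_neg hk]; simp]
  refine Finset.sum_congr rfl fun k hk => ?_
  rw [coeffI_ridgePoly hd, if_pos hk, Real.rpow_one]

lemma IsQuadrature.sum_mul {s n : ℕ} {lam : Fin n → ℝ} {ξ : Fin n → S d}
    (hQ : IsQuadrature d (2 * s) n lam ξ) {k : ℕ} (hk : k ≤ s) {a b : MvPolynomial (Fin d) ℝ}
    (ha : a.IsHomogeneous k) (hb : b.IsHomogeneous k) :
    sphereInt d (a * b) = ∑ l, lam l * (polyFun a (ξ l : E d) * polyFun b (ξ l : E d)) := by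
  rw [sphereInt_apply, hQ.exact _ ((ha.mul hb).totalDegree_le.trans (by omega))]
  simp only [polyFun_mul]

/-- Each of the d - 1 factors k + 1 + i, with i + 1 ≤ d, is at most d(k+1). -/
lemma v_sq_le (hd : 1 ≤ d) (k : ℕ) :
    v d k ^ 2 ≤ (d : ℝ) ^ (d - 1) / (2 * (2 * Real.pi) ^ (d - 1)) * ((k : ℝ) + 1) ^ (d - 1) := by
  have h : risingFactorial ((k : ℝ) + 1) (d - 1) ≤ (d : ℝ) ^ (d - 1) * ((k : ℝ) + 1) ^ (d - 1) := by
    rw [← mul_pow]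
    refine (Finset.prod_le_prod (g := fun _ => (d : ℝ) * (k + 1)) (fun i _ => by positivity)
      fun i hi => ?_).trans_eq (by simp)
    have : i + 1 ≤ d := by have := Finset.mem_range.1 hi; omega
    have h1 : ((i : ℝ) + 1) ≤ d := by exact_mod_cast this
    have h2 : (1 : ℝ) ≤ d := by exact_mod_cast hd
    nlinarith [(Nat.cast_nonneg k : (0 : ℝ) ≤ k)]
  rw [v_sq, div_mul_eq_mul_div]
  exact div_le_div_of_nonneg_right h (by positivity)

lemma memLp_polyFun (P : MvPolynomial (Fin d) ℝ) :
    MemLp (polyFun P) 2 (volume.restrict (unitBall d)) :=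
  (memLp_two_iff_integrable_sq (continuous_polyFun P).aestronglyMeasurable).2
    (((continuous_polyFun P).pow 2).continuousOn.integrableOn_compact (isCompact_closedBall _ _))

end RidgeBall
end

/-! ### Discretisation by quadrature and the norm bound -/

theorem mainTheorem3 (d : ℕ) (hd : 1 ≤ d) :
    ∃ c : ℝ, 0 < c ∧
      ∀ (Y : (j : ℕ) → Fin (RidgeBall.harmonicDim d j) → RidgeBall.S d → ℝ),
        RidgeBall.IsHarmonicONB d Y →
      ∀ (s n : ℕ) (lam : Fin n → ℝ) (ξ : Fin n → RidgeBall.S d),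
        RidgeBall.IsQuadrature d (2 * s) n lam ξ →
      ∀ P : MvPolynomial (Fin d) ℝ, P.totalDegree ≤ s →
        (∀ x ∈ RidgeBall.unitBall d,
          RidgeBall.polyFun P x =
            ∑ l, lam l * (RidgeBall.ridgePoly d s (RidgeBall.polyFun P) (ξ l)).eval
              (inner ℝ (ξ l : RidgeBall.E d) x)) ∧
        (∀ l, RidgeBall.MemW d 1
          (fun t => (RidgeBall.ridgePoly d s (RidgeBall.polyFun P) (ξ l)).eval t)) ∧
        RidgeBall.MemH d Y (((d : ℝ) + 1) / 2) (RidgeBall.polyFun P) ∧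
        ∑ l, lam l * RidgeBall.normSqW d 1
            (fun t => (RidgeBall.ridgePoly d s (RidgeBall.polyFun P) (ξ l)).eval t) ≤
          c * RidgeBall.normSqH d Y (((d : ℝ) + 1) / 2) (RidgeBall.polyFun P) := by
  open RidgeBall in
  have hd0 : (0 : ℝ) < d := by exact_mod_cast hd
  refine ⟨(d : ℝ) ^ (d - 1) / (2 * (2 * Real.pi) ^ (d - 1)), by have := Real.pi_pos; positivity,
    fun Y hY s n lam ξ hQ P hP => ?_⟩
  choose a ha ha' using fun k => exists_ridgeCoeff k P
  -- A_k vanishes for k > s by orthogonality to lower degrees, so the H-norm series is a finite sum.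
  have ha0 : ∀ k ∉ Finset.range (s + 1), ∀ η : S d, polyFun (a k) (η : E d) = 0 := by
    intro k hk η
    rw [ha', ridgeCoeff_of_lt hd]
    simp only [Finset.mem_range] at hk
    omega
  have hterm : ∀ k : ℕ, ∑ j ∈ parityIndices k, ∑ i : Fin (harmonicDim d j),
      (((k : ℝ) + 1) ^ (((d : ℝ) + 1) / 2) * coeffBall d Y (polyFun P) k j i) ^ 2 =
      ((k : ℝ) + 1) ^ (d + 1) * v d k ^ 2 * sphereInt d (a k * a k) := by
    intro k
    rw [hY.sum_coeffBall_sq hd P _ (ha k) (ha' k), ← Real.rpow_natCast _ 2, ← Real.rpow_mul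
      (by positivity), ← Real.rpow_natCast _ (d + 1)]
    congr 3
    push_cast
    ring
  have hzero : ∀ k ∉ Finset.range (s + 1), ∑ j ∈ parityIndices k, ∑ i : Fin (harmonicDim d j),
      (((k : ℝ) + 1) ^ (((d : ℝ) + 1) / 2) * coeffBall d Y (polyFun P) k j i) ^ 2 = 0 := by
    intro k hk
    rw [hterm, sphereInt_apply]
    simp [ha0 k hk]
  refine ⟨fun x _ => ?_, fun l => memW_ridgePoly hd 1 s P (ξ l),
    ⟨memLp_polyFun P, summable_of_ne_finset_zero hzero⟩, ?_⟩
  · rw [polyFun_eq_sum_integral hd hP x]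
    simp only [ridgePoly_eq, eval_finsetSum, eval_smul, smul_eq_mul, Finset.mul_sum]
    rw [Finset.sum_comm]
    refine Finset.sum_congr rfl fun k hk => ?_
    obtain ⟨b, hb, hb'⟩ := exists_U_inner k x
    -- Exactness to degree 2s is used for the product of two homogeneous polynomials of degree k ≤
    -- s.
    have h := hQ.sum_mul (by simpa [Nat.lt_succ_iff] using hk) hb (ha k)
    rw [sphereInt_apply] at h
    simp only [polyFun_mul, hb', ha'] at h
    rw [h, Finset.mul_sum]
    exact Finset.sum_congr rfl fun l _ => by ring
  · rw [normSqH, tsum_eq_sum hzero]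
    simp only [hterm, normSqW_ridgePoly hd, Finset.mul_sum]
    rw [Finset.sum_comm]
    refine Finset.sum_le_sum fun k hk => ?_
    have h := hQ.sum_mul (by simpa [Nat.lt_succ_iff] using hk) (ha k) (ha k)
    simp only [ha'] at h
    have e : ∑ l, lam l * (((k : ℝ) + 1) * (v d k ^ 2 * ridgeCoeff d k P (ξ l))) ^ 2
        = ((k : ℝ) + 1) ^ 2 * v d k ^ 2 * sphereInt d (a k * a k) * v d k ^ 2 := by
      rw [h, Finset.mul_sum, Finset.sum_mul]
      exact Finset.sum_congr rfl fun l _ => by ring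
    rw [e]
    have hnn : 0 ≤ sphereInt d (a k * a k) := by
      rw [sphereInt_apply]
      exact integral_nonneg fun η => by rw [polyFun_mul]; exact mul_self_nonneg _
    -- One of the two factors v_k² is traded for c (k+1)^{d-1}, which raises (k+1)² to the
    -- (k+1)^{d+1} of the H-norm.
    refine (mul_le_mul_of_nonneg_left (v_sq_le hd k) (by positivity)).trans_eq ?_
    obtain ⟨m, rfl⟩ : ∃ m, d = m + 1 := ⟨d - 1, by omega⟩
    simp only [Nat.add_sub_cancel]
    ring
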